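/- \textbf{Setting.} Let $X\in\mathbb{R}^{n\times d_x}$, $Y\in\mathbb{R}^{n\times d_y}$, $\lambda_x,\lambda_y\ge 0$, and put $\Sigma_{xx}=X^TX+\lambda_xI$, $\Sigma_{yy}=Y^TY+\lambda_yI$, $\Sigma_{xy}=X^TY$, $\Sigma=\mathrm{blockdiag}(\Sigma_{xx},\Sigma_{yy})$; assume that $\Sigma$ is symmetric positive definite (SPD). Let $m=\min(d_x,d_y)$. The canonical correlations $\sigma_1\ge\dots\ge\sigma_m$ are the numbers for which some $(U,V)\in\mathbb{R}^{d_x\times m}\times\mathbb{R}^{d_y\times m}$ maximizes $\mathrm{tr}(U^T\Sigma_{xy}V)$ subject to $U^T\Sigma_{xx}U=I_m$, $V^T\Sigma_{yy}V=I_m$, $U^T\Sigma_{xy}V=\mathrm{diag}(\sigma_1,\dots,\sigma_m)$ with non-increasing diagonal; put $\sigma_i=0$ for $i>m$. Let $1\le p\le m$, $p<\max(d_x,d_y)$, $\mu_1>\dots>\mu_p>0$, $N=\mathrm{diag}(\mu_1,\dots,\mu_p)$, and consider \[ f_{\rm CCA}(Z)=-\tfrac12\,\mathrm{tr}\Big(Z^T\begin{bmatrix}0&\Sigma_{xy}\\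 \Sigma_{xy}^T&0\end{bmatrix}ZN\Big) \] on $\mathbb{S}_{xy}=\{Z=\begin{bmatrix}U\\V\end{bmatrix}\in\mathbb{R}^{(d_x+d_y)\times p}:\ U^T\Sigma_{xx}U=I_p,\ V^T\Sigma_{yy}V=I_p\}$, with the Riemannian metric $g_Z(\xi,\eta)=\mathrm{tr}(\xi^TM\eta)$ on the tangent spaces, where $M=\mathrm{blockdiag}(M^{(xx)},M^{(yy)})$ with SPD matrices $M^{(xx)}\in\mathbb{R}^{d_x\times d_x}$, $M^{(yy)}\in\mathbb{R}^{d_y\times d_y}$. The condition number $\kappa$ of a self-adjoint operator is the ratio of the largest to the smallest absolute value of its eigenvalues, and $\kappa(\Sigma,M)$ is the ratio of the largest to the smallest generalized eigenvalue of the pencil $(\Sigma,M)$. \textbf{Theorem.} Assume $\sigma_1>\sigma_2>\dots>\sigma_{p+1}\ge0$, and let $Z^\star$ be a global minimizer of $f_{\rm CCA}$ on $\mathbb{S}_{xy}$. Then the Riemannian Hessian $\mathrm{Hess}f_{\rm CCA}(Z^\star):T_{Z^\star}\mathbb{S}_{xy}\to T_{Z^\star}\mathbb{S}_{xy}$ is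 nonsingular and \[ \kappa(\mathrm{Hess}f_{\rm CCA}(Z^\star))\le\kappa^\star_{\rm CCA}\cdot\kappa(\Sigma,M), \] \[ \kappa^\star_{\rm CCA}=\frac{\max\{\mu_1(\sigma_1+\sigma_{p+1}),\ \frac12(\mu_1+\mu_2)(\sigma_1+\sigma_2)\}}{\min\{\mu_p(\sigma_p-\sigma_{p+1}),\ \min_{1\le j<p}\frac12(\mu_j-\mu_{j+1})(\sigma_j-\sigma_{j+1})\}}, \] where for $p=1$ the second entries of the maximum and of the minimum are omitted. If $M=\Sigma$, then $\kappa(\mathrm{Hess}f_{\rm CCA}(Z^\star))=\kappa^\star_{\rm CCA}$. -/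

import Mathlib

open Matrix

/-- Matrices carry a norm only so that `fderiv` makes sense; in finite dimension derivatives do not
depend on which norm is chosen. -/
noncomputable local instance ccaMatrixNormedAddCommGroup {m n : Type*} [Fintype m] [Fintype n] :
    NormedAddCommGroup (Matrix m n ℝ) := Matrix.normedAddCommGroup

noncomputable local instance ccaMatrixNormedSpace {m n : Type*} [Fintype m] [Fintype n] :
    NormedSpace ℝ (Matrix m n ℝ) := Matrix.normedSpace

namespace CCA

noncomputable section

/-! ### Condition numbers -/

/-- `κ` is the condition number of an operator whose set of eigenvalues is `Λ`: the eigenvalues of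
largest and of smallest absolute value exist, the smallest absolute value is positive, and `κ` is
the ratio of the largest to the smallest absolute value. -/
def HasConditionNumber (Λ : Set ℝ) (κ : ℝ) : Prop :=
  ∃ a b : ℝ, IsGreatest ((fun l : ℝ => |l|) '' Λ) a ∧ IsLeast ((fun l : ℝ => |l|) '' Λ) b ∧
    0 < b ∧ κ = a / b

/-- The generalized eigenvalues of the matrix pencil `(A, B)`: the real `l` such that
`A v = l B v` for some `v` outside the kernel of `B`. -/
def pencilEigenvalues {d : Type*} [Fintype d] (A B : Matrix d d ℝ) : Set ℝ :=
  {l | ∃ v : d → ℝ, B *ᵥ v ≠ 0 ∧ A *ᵥ v = l • (B *ᵥ v)}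

/-! ### Riemannian geometry of submanifolds of a matrix space

The ambient space is `Matrix d c ℝ` with the constant inner product `tr (ξᵀ M η)`.
A submanifold enters through its tangent spaces `T Z`. -/

/-- The inner product `tr (ξᵀ M η)`. -/
def metric {d c : Type*} [Fintype d] [Fintype c] (M : Matrix d d ℝ) (ξ η : Matrix d c ℝ) : ℝ :=
  trace (ξᵀ * M * η)

/-- The orthogonal projection of `W` on the subspace `T` with respect to the inner product
`tr (ξᵀ M η)`: the element `P` of `T` for which `W - P` is orthogonal to `T`
(for positive definite `M` it exists and is unique). -/
def proj {d c : Type*} [Fintype d] [Fintype c] (M : Matrix d d ℝ)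
    (T : Submodule ℝ (Matrix d c ℝ)) (W : Matrix d c ℝ) : Matrix d c ℝ :=
  Classical.epsilon fun P => P ∈ T ∧ ∀ η ∈ T, metric M (W - P) η = 0

/-- The Riemannian gradient at `Z` of (the restriction of) `f`: the tangent vector that represents
the differential of `f` on the tangent space with respect to the metric
(for positive definite `M` it exists and is unique). -/
def riemannianGradient {d c : Type*} [Fintype d] [Fintype c] (M : Matrix d d ℝ)
    (T : Matrix d c ℝ → Submodule ℝ (Matrix d c ℝ)) (f : Matrix d c ℝ → ℝ) (Z : Matrix d c ℝ) :
    Matrix d c ℝ :=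
  Classical.epsilon fun G => G ∈ T Z ∧ ∀ η ∈ T Z, metric M G η = fderiv ℝ f Z η

/-- The Riemannian Hessian `Hess f(Z)[ξ] = ∇_ξ grad f` for the Levi-Civita connection of the
submanifold. The ambient metric is constant, so the covariant derivative of the gradient field is
the orthogonal projection on the tangent space of the ordinary directional derivative of the field
(extended to a neighbourhood of the submanifold in the ambient space; for tangent `ξ` the result
does not depend on the extension). -/
def riemannianHessian {d c : Type*} [Fintype d] [Fintype c] (M : Matrix d d ℝ)
    (T : Matrix d c ℝ → Submodule ℝ (Matrix d c ℝ)) (f : Matrix d c ℝ → ℝ) (Z ξ : Matrix d c ℝ) :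
    Matrix d c ℝ :=
  proj M (T Z) (fderiv ℝ (riemannianGradient M T f) Z ξ)

/-- The eigenvalues of the Riemannian Hessian as an operator on the tangent space at `Z`. -/
def riemannianHessianEigenvalues {d c : Type*} [Fintype d] [Fintype c] (M : Matrix d d ℝ)
    (T : Matrix d c ℝ → Submodule ℝ (Matrix d c ℝ)) (f : Matrix d c ℝ → ℝ) (Z : Matrix d c ℝ) :
    Set ℝ :=
  {l | ∃ ξ ∈ T Z, ξ ≠ 0 ∧ riemannianHessian M T f Z ξ = l • ξ}

/-! ### Generalized Stiefel manifolds and their products -/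

/-- The generalized Stiefel manifold `{X : Xᵀ B X = I}`. -/
def genStiefel {d : Type*} [Fintype d] (B : Matrix d d ℝ) (p : ℕ) : Set (Matrix d (Fin p) ℝ) :=
  {X | Xᵀ * B * X = 1}

/-- The tangent space `{ξ : ξᵀ B X + Xᵀ B ξ = 0}` of the generalized Stiefel manifold at `X`.
(For `X` of full column rank off the manifold it is the tangent space of the level set of
`X ↦ Xᵀ B X` through `X`.) -/
def genStiefelTangent {d : Type*} [Fintype d] {p : ℕ} (B : Matrix d d ℝ) (X : Matrix d (Fin p) ℝ) :
    Submodule ℝ (Matrix d (Fin p) ℝ) where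
  carrier := {ξ | ξᵀ * B * X + Xᵀ * B * ξ = 0}
  zero_mem' := by simp
  add_mem' := by
    intro a b ha hb
    simp only [Set.mem_ofPred_eq] at ha hb ⊢
    rw [transpose_add, Matrix.add_mul, Matrix.add_mul, Matrix.mul_add, add_add_add_comm, ha, hb,
      add_zero]
  smul_mem' := by
    intro r a ha
    simp only [Set.mem_ofPred_eq] at ha ⊢
    rw [transpose_smul, Matrix.smul_mul, Matrix.smul_mul, Matrix.mul_smul, ← smul_add, ha,
      smul_zero]

/-- The product of two generalized Stiefel manifolds, as a set of stacked matrices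
`Z = [U; V]` with upper block `U = Z.toRows₁` and lower block `V = Z.toRows₂`. -/
def prodStiefel {d₁ d₂ : Type*} [Fintype d₁] [Fintype d₂] (B₁ : Matrix d₁ d₁ ℝ)
    (B₂ : Matrix d₂ d₂ ℝ) (p : ℕ) : Set (Matrix (d₁ ⊕ d₂) (Fin p) ℝ) :=
  {Z | Z.toRows₁ ∈ genStiefel B₁ p ∧ Z.toRows₂ ∈ genStiefel B₂ p}

/-- The tangent space of the product: the product of the tangent spaces. -/
def prodStiefelTangent {d₁ d₂ : Type*} [Fintype d₁] [Fintype d₂] {p : ℕ} (B₁ : Matrix d₁ d₁ ℝ)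
    (B₂ : Matrix d₂ d₂ ℝ) (Z : Matrix (d₁ ⊕ d₂) (Fin p) ℝ) :
    Submodule ℝ (Matrix (d₁ ⊕ d₂) (Fin p) ℝ) where
  carrier := {ξ | ξ.toRows₁ ∈ genStiefelTangent B₁ Z.toRows₁ ∧
    ξ.toRows₂ ∈ genStiefelTangent B₂ Z.toRows₂}
  zero_mem' := ⟨Submodule.zero_mem _, Submodule.zero_mem _⟩
  add_mem' := fun ha hb => ⟨Submodule.add_mem _ ha.1 hb.1, Submodule.add_mem _ ha.2 hb.2⟩
  smul_mem' := fun r _ ha => ⟨Submodule.smul_mem _ r ha.1, Submodule.smul_mem _ r ha.2⟩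

/-! ### Canonical correlation analysis -/

/-- The regularized Gram matrix `Xᵀ X + lam I`. -/
def gram {n d : ℕ} (X : Matrix (Fin n) (Fin d) ℝ) (lam : ℝ) : Matrix (Fin d) (Fin d) ℝ :=
  Xᵀ * X + lam • (1 : Matrix (Fin d) (Fin d) ℝ)

/-- The block diagonal matrix with diagonal blocks `A` and `B`. -/
def blockDiag₂ {dx dy : ℕ} (A : Matrix (Fin dx) (Fin dx) ℝ) (B : Matrix (Fin dy) (Fin dy) ℝ) :
    Matrix (Fin dx ⊕ Fin dy) (Fin dx ⊕ Fin dy) ℝ :=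
  fromBlocks A 0 0 B

/-- The constraints in the definition of canonical correlations `s` with weights the columns of
`U` and `V`: `Uᵀ Sxx U = I`, `Vᵀ Syy V = I`, `Uᵀ Sxy V = diag s`, with `s` non-increasing. -/
structure IsFeasible {dx dy q : ℕ} (Sxx : Matrix (Fin dx) (Fin dx) ℝ)
    (Syy : Matrix (Fin dy) (Fin dy) ℝ) (Sxy : Matrix (Fin dx) (Fin dy) ℝ)
    (s : Fin q → ℝ) (U : Matrix (Fin dx) (Fin q) ℝ) (V : Matrix (Fin dy) (Fin q) ℝ) : Prop where
  left : Uᵀ * Sxx * U = 1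
  right : Vᵀ * Syy * V = 1
  diag : Uᵀ * Sxy * V = diagonal s
  antitone : Antitone s

/-- `s` is the family of the `(lx, ly)`-canonical correlations of the data matrices `X` and `Y`
(`s 0` is the largest): for some weights `U`, `V`, the triple `(s, U, V)` maximizes
`tr (Uᵀ Xᵀ Y V)` under the constraints. The number of canonical correlations is the largest number
of columns for which the constraints can be met, `min dx dy`. -/
def IsCanonicalCorrelations {n dx dy : ℕ} (X : Matrix (Fin n) (Fin dx) ℝ)
    (Y : Matrix (Fin n) (Fin dy) ℝ) (lx ly : ℝ) (s : Fin (min dx dy) → ℝ) : Prop :=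
  ∃ (U : Matrix (Fin dx) (Fin (min dx dy)) ℝ) (V : Matrix (Fin dy) (Fin (min dx dy)) ℝ),
    IsFeasible (gram X lx) (gram Y ly) (Xᵀ * Y) s U V ∧
    ∀ (s' : Fin (min dx dy) → ℝ) (U' : Matrix (Fin dx) (Fin (min dx dy)) ℝ)
      (V' : Matrix (Fin dy) (Fin (min dx dy)) ℝ),
      IsFeasible (gram X lx) (gram Y ly) (Xᵀ * Y) s' U' V' →
        trace (U'ᵀ * (Xᵀ * Y) * V') ≤ trace (Uᵀ * (Xᵀ * Y) * V)

/-- The cost function `-½ tr (Zᵀ [0, Sxy; Sxyᵀ, 0] Z N)` with `N = diag (μ)`. -/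
def cost {dx dy p : ℕ} (Sxy : Matrix (Fin dx) (Fin dy) ℝ) (μ : Fin p → ℝ)
    (Z : Matrix (Fin dx ⊕ Fin dy) (Fin p) ℝ) : ℝ :=
  -(1 / 2) * trace (Zᵀ * fromBlocks 0 Sxy Sxyᵀ 0 * Z * diagonal μ)

/-- One-based indexing of a finite sequence, continued by zero:
`term a 1, …, term a m` are the entries of `a : Fin m → ℝ`. -/
def term {m : ℕ} (a : Fin m → ℝ) (k : ℕ) : ℝ :=
  if h : 1 ≤ k ∧ k ≤ m then a ⟨k - 1, by omega⟩ else 0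

/-- The numerator
`max {μ₁ (σ₁ + σ_{p+1}), ½ (μ₁ + μ₂) (σ₁ + σ₂)}`; the second entry is absent if `p = 1`. -/
def kappaStarNum (p : ℕ) (μ σ : ℕ → ℝ) : ℝ :=
  if 2 ≤ p then
    max (μ 1 * (σ 1 + σ (p + 1))) (1 / 2 * (μ 1 + μ 2) * (σ 1 + σ 2))
  else μ 1 * (σ 1 + σ (p + 1))

/-- The denominator
`min {μ_p (σ_p - σ_{p+1}), min_{1 ≤ j < p} ½ (μ_j - μ_{j+1}) (σ_j - σ_{j+1})}`. -/
def kappaStarDen (p : ℕ) (μ σ : ℕ → ℝ) : ℝ :=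
  (Finset.Ico 1 p).fold min (μ p * (σ p - σ (p + 1)))
    (fun j => 1 / 2 * (μ j - μ (j + 1)) * (σ j - σ (j + 1)))

/-- The baseline condition number `κ*_CCA`. -/
def kappaStar (p : ℕ) (μ σ : ℕ → ℝ) : ℝ :=
  kappaStarNum p μ σ / kappaStarDen p μ σ

end

end CCA

/-! At a critical point the Riemannian Hessian is represented on the tangent space by the Euclidean
Hessian corrected by Lagrange multipliers (`riemannianHessian_spec`). The gradient is only specified
pointwise, so its differentiability has to be earned: gradient and multipliers together solve a
linear system depending linearly on the point, invertible on the manifold and hence near it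
(`system_injective`, `exists_hasFDerivAt_solution`).

The form becomes explicit in canonical bases, orthonormal for Σxx and Σyy, in which Σxy is
rectangular diagonal with entries σ_i (`exists_canonical_bases`). A minimizer consists, up to signs
common to both blocks, of the first p vectors of these bases. This is the equality case of a trace
inequality proved by linear programming duality (`weighted_sum_sq_le`, `eq_frame_of_trace_ge`). The
multipliers are then -μ_k σ_k.

A tangent vector has coordinates (a, b) whose upper p × p blocks are skew and whose other rows are
free, and the Hessian form is the sum of μ_k (σ_k (a_ik² + b_ik²) - 2 σ_i a_ik b_ik). It splits into
blocks of size at most two. Relative to the Σ-metric their eigenvalues are μ_k (σ_k ± σ_i) for i >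
p, and ½ (μ_i ± μ_k)(σ_i ± σ_k), with equal signs, for i < k ≤ p. Where row i exists in only one of
the two bases, σ_i = 0 and both signs agree. Monotonicity of μ and σ locates the extreme values
(`le_coordForm`, `coordForm_le`), which are the denominator and the numerator of κ*; explicit
tangent vectors attain them.

For a general metric M, the Rayleigh quotient relative to M is the one relative to Σ times a
quotient of Σ by M, and the latter lies between the extreme eigenvalues of the pencil
(`exists_pencil_bounds`). Since the Hessian is positive, its condition number is the ratio of the
extreme Rayleigh quotients; for M = Σ the bounds are attained. -/

namespace CCA

/-! ### Eigenvalues of a symmetric form relative to a positive definite form -/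

/-- The eigenvalues of the bilinear form `H` relative to the bilinear form `g` on a subspace. -/
def formEigenvalues {E : Type*} [AddCommGroup E] [Module ℝ E] (T : Submodule ℝ E)
    (H g : LinearMap.BilinForm ℝ E) : Set ℝ :=
  {l | ∃ x ∈ T, x ≠ 0 ∧ ∀ y ∈ T, H x y = l * g x y}

/-- A vector isotropic for a nonnegative form lies in its radical: `q` at `t • x + y` is affine in
`t` and bounded below, so its slope vanishes. -/
lemma form_eq_zero_of_nonneg {E : Type*} [AddCommGroup E] [Module ℝ E] {T : Submodule ℝ E}
    {q : LinearMap.BilinForm ℝ E} (hsymm : ∀ x y, q x y = q y x)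
    (hq : ∀ x ∈ T, 0 ≤ q x x) {x : E} (hx : x ∈ T) (hx0 : q x x = 0) {y : E} (hy : y ∈ T) :
    q x y = 0 := by
  by_contra hne
  have key : ∀ t : ℝ, 0 ≤ 2 * t * q x y + q y y := by
    intro t
    have := hq (t • x + y) (T.add_mem (T.smul_mem t hx) hy)
    simp only [map_add, map_smul, LinearMap.add_apply, LinearMap.smul_apply, smul_eq_mul,
      hx0, hsymm y x] at this
    linarith
  -- This `t` makes the affine function equal to -1.
  have h := key (-(q y y + 1) / (2 * q x y))
  have : 2 * (-(q y y + 1) / (2 * q x y)) * q x y = -(q y y + 1) := by field_simp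
  rw [this] at h
  linarith

section Rayleigh

variable {E : Type*} [NormedAddCommGroup E] [NormedSpace ℝ E] [FiniteDimensional ℝ E]
  {T : Submodule ℝ E} {H g : LinearMap.BilinForm ℝ E}

lemma continuous_form_self (H : LinearMap.BilinForm ℝ E) : Continuous fun x => H x x := by
  have h : Continuous (LinearMap.toContinuousLinearMap.toLinearMap ∘ₗ H :
      E →ₗ[ℝ] E →L[ℝ] ℝ) := LinearMap.continuous_of_finiteDimensional _
  exact h.clm_apply continuous_id

/-- The smallest eigenvalue of a symmetric form relative to a positive definite one exists and is
the minimum of the Rayleigh quotient. -/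
theorem exists_isLeast_formEigenvalues (hT : T ≠ ⊥) (hH : ∀ x y, H x y = H y x)
    (hg : ∀ x y, g x y = g y x) (hpos : ∀ x ∈ T, x ≠ 0 → 0 < g x x) :
    ∃ lo, IsLeast (formEigenvalues T H g) lo ∧ ∀ x ∈ T, lo * g x x ≤ H x x := by
  obtain ⟨w, hw, hw0⟩ := T.exists_mem_ne_zero_of_ne_bot hT
  have : ProperSpace E := FiniteDimensional.proper_real E
  have hcompact : IsCompact (Metric.sphere (0 : E) 1 ∩ T) :=
    (isCompact_sphere (0 : E) 1).inter_right T.closed_of_finiteDimensional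
  have hne0 : ∀ x ∈ Metric.sphere (0 : E) 1 ∩ T, x ≠ 0 := by
    rintro x ⟨hx, -⟩ rfl
    simp at hx
  have hnonempty : (Metric.sphere (0 : E) 1 ∩ T).Nonempty :=
    ⟨‖w‖⁻¹ • w, by simp [norm_smul, hw0], T.smul_mem _ hw⟩
  obtain ⟨x, hxS, hx⟩ := hcompact.exists_isMinOn (f := fun x => H x x / g x x) hnonempty
    ((continuous_form_self H).continuousOn.div (continuous_form_self g).continuousOn
      fun x hx => (hpos x hx.2 (hne0 x hx)).ne')
  have hgx := hpos x hxS.2 (hne0 x hxS)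
  have hle : ∀ y ∈ T, H x x / g x x * g y y ≤ H y y := by
    intro y hy
    rcases eq_or_ne y 0 with rfl | hy0
    · simp
    have h1 : H x x / g x x ≤ _ := hx (show ‖y‖⁻¹ • y ∈ Metric.sphere (0 : E) 1 ∩ T from
      ⟨by simp [norm_smul, hy0], T.smul_mem _ hy⟩)
    have hn : ‖y‖⁻¹ ≠ 0 := by simpa using hy0
    have h2 : H (‖y‖⁻¹ • y) (‖y‖⁻¹ • y) / g (‖y‖⁻¹ • y) (‖y‖⁻¹ • y) = H y y / g y y := by
      simp only [map_smul, LinearMap.smul_apply, smul_eq_mul]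
      rw [mul_div_mul_left _ _ hn, mul_div_mul_left _ _ hn]
    simp only [h2] at h1
    exact (le_div_iff₀ (hpos y hy hy0)).1 h1
  refine ⟨H x x / g x x, ⟨⟨x, hxS.2, hne0 x hxS, fun y hy => ?_⟩, ?_⟩, hle⟩
  -- The form `H - lo * g` is nonnegative on `T` and vanishes at the minimizer, which therefore lies
  -- in its radical; this is the eigenvalue equation.
  · have := form_eq_zero_of_nonneg (T := T) (q := H - (H x x / g x x) • g)
      (by intro a b; simp [hH a b, hg a b])
      (by intro a ha; simpa using hle a ha) hxS.2 (by simp [hgx.ne']) hy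
    simpa [sub_eq_zero] using this
  · rintro l ⟨y, hy, hy0, hyl⟩
    have h1 := hle y hy
    rw [hyl y hy] at h1
    exact le_of_mul_le_mul_right h1 (hpos y hy hy0)

/-- The largest eigenvalue of a symmetric form relative to a positive definite one exists and is
the maximum of the Rayleigh quotient. -/
theorem exists_isGreatest_formEigenvalues (hT : T ≠ ⊥) (hH : ∀ x y, H x y = H y x)
    (hg : ∀ x y, g x y = g y x) (hpos : ∀ x ∈ T, x ≠ 0 → 0 < g x x) :
    ∃ hi, IsGreatest (formEigenvalues T H g) hi ∧ ∀ x ∈ T, H x x ≤ hi * g x x := by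
  obtain ⟨lo, ⟨⟨x, hx, hx0, hxl⟩, hlo⟩, hle⟩ := exists_isLeast_formEigenvalues (H := -H) hT
    (by intro x y; simp [hH x y]) hg hpos
  refine ⟨-lo, ⟨⟨x, hx, hx0, fun y hy => ?_⟩, ?_⟩, fun y hy => ?_⟩
  · have := hxl y hy
    simp only [LinearMap.neg_apply] at this
    linarith
  · rintro l ⟨y, hy, hy0, hyl⟩
    have : lo ≤ -l := hlo ⟨y, hy, hy0, fun z hz => by simp [hyl z hz]⟩
    linarith
  · have := hle y hy
    simp only [LinearMap.neg_apply] at this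
    linarith

end Rayleigh

lemma hasConditionNumber_of_isLeast {Λ : Set ℝ} {lo hi : ℝ} (hlo : IsLeast Λ lo)
    (hhi : IsGreatest Λ hi) (hpos : 0 < lo) : HasConditionNumber Λ (hi / lo) := by
  have habs : (fun l : ℝ => |l|) '' Λ = Λ := by
    have h : Set.EqOn (fun l : ℝ => |l|) id Λ := fun l hl => abs_of_pos (hpos.trans_le (hlo.2 hl))
    rw [h.image_eq, Set.image_id]
  exact ⟨hi, lo, by rwa [habs], by rwa [habs], hpos, rfl⟩


/-! ### The metric -/

section Metric

variable {d c : Type*} [Fintype d] [Fintype c] {M : Matrix d d ℝ}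

lemma metric_eq_sum (M : Matrix d d ℝ) (ξ η : Matrix d c ℝ) :
    metric M ξ η = ∑ k, ξ.col k ⬝ᵥ M *ᵥ η.col k := by
  unfold metric
  rw [Matrix.mul_assoc]
  simp only [trace, diag_apply, mul_apply, transpose_apply, dotProduct, mulVec, col_apply]

lemma metric_pos (hM : M.PosDef) {ξ : Matrix d c ℝ} (hξ : ξ ≠ 0) : 0 < metric M ξ ξ := by
  rw [metric_eq_sum]
  obtain ⟨k, hk⟩ : ∃ k, ξ.col k ≠ 0 := by
    by_contra! h
    exact hξ (by ext i k; exact congrFun (h k) i)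
  refine Finset.sum_pos' (fun k _ => ?_) ⟨k, Finset.mem_univ k, ?_⟩
  · simpa using hM.posSemidef.dotProduct_mulVec_nonneg (ξ.col k)
  · simpa using hM.dotProduct_mulVec_pos hk

lemma metric_comm (hM : M.PosDef) (ξ η : Matrix d c ℝ) : metric M ξ η = metric M η ξ := by
  have : Mᵀ = M := by simpa using hM.isHermitian.eq
  unfold metric
  rw [← trace_transpose]
  simp [this, Matrix.mul_assoc]

/-- `metric M` as a bilinear form. -/
noncomputable def metricForm (M : Matrix d d ℝ) : LinearMap.BilinForm ℝ (Matrix d c ℝ) :=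
  LinearMap.mk₂ ℝ (metric M)
    (by intros; simp [metric, Matrix.add_mul])
    (by intros; simp [metric])
    (by intros; simp [metric, Matrix.mul_add])
    (by intros; simp [metric])

lemma metricForm_apply (M : Matrix d d ℝ) (ξ η : Matrix d c ℝ) :
    metricForm M ξ η = metric M ξ η := rfl

lemma metric_eq_of_forall (hM : M.PosDef) {T : Submodule ℝ (Matrix d c ℝ)} {ξ η : Matrix d c ℝ}
    (hξ : ξ ∈ T) (hη : η ∈ T) (h : ∀ ζ ∈ T, metric M ξ ζ = metric M η ζ) : ξ = η := by
  by_contra hne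
  have h1 := metric_pos hM (sub_ne_zero.2 hne)
  have h2 := h _ (T.sub_mem hξ hη)
  rw [← metricForm_apply] at h1
  rw [← metricForm_apply, ← metricForm_apply] at h2
  rw [LinearMap.map_sub₂] at h1
  linarith

/-- Riesz representation: definiteness makes the map from `T` to its dual injective, and equal
dimensions make it surjective. -/
lemma exists_proj (hM : M.PosDef) (T : Submodule ℝ (Matrix d c ℝ)) (W : Matrix d c ℝ) :
    ∃ P ∈ T, ∀ η ∈ T, metric M (W - P) η = 0 := by
  let Φ : T →ₗ[ℝ] Module.Dual ℝ T := (metricForm M).domRestrict₁₂ T T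
  have hinj : Function.Injective Φ := by
    intro a b hab
    exact Subtype.ext (metric_eq_of_forall hM a.2 b.2 fun ζ hζ =>
      LinearMap.congr_fun hab ⟨ζ, hζ⟩)
  have hsurj : Function.Surjective Φ :=
    (LinearMap.injective_iff_surjective_of_finrank_eq_finrank
      (Subspace.dual_finrank_eq (K := ℝ) (V := T)).symm).1 hinj
  obtain ⟨P, hP⟩ := hsurj ((metricForm M W).domRestrict T)
  refine ⟨P, P.2, fun η hη => ?_⟩
  have h : metric M P η = metric M W η := LinearMap.congr_fun hP ⟨η, hη⟩
  rw [← metricForm_apply, map_sub, LinearMap.sub_apply, metricForm_apply, metricForm_apply, h,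
    sub_self]

lemma proj_spec (hM : M.PosDef) (T : Submodule ℝ (Matrix d c ℝ)) (W : Matrix d c ℝ) :
    proj M T W ∈ T ∧ ∀ η ∈ T, metric M (proj M T W) η = metric M W η := by
  obtain ⟨P, hP⟩ := exists_proj hM T W
  have h : proj M T W ∈ T ∧ ∀ η ∈ T, metric M (W - proj M T W) η = 0 :=
    Classical.epsilon_spec (p := fun P => P ∈ T ∧ ∀ η ∈ T, metric M (W - P) η = 0) ⟨P, hP⟩
  refine ⟨h.1, fun η hη => ?_⟩
  have := h.2 η hη
  rw [← metricForm_apply, map_sub, LinearMap.sub_apply, metricForm_apply, metricForm_apply] at this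
  linarith

/-- Identifies the vector selected by `Classical.epsilon`: a representing tangent vector is unique.
-/
lemma riemannianGradient_eq (hM : M.PosDef) {T : Matrix d c ℝ → Submodule ℝ (Matrix d c ℝ)}
    {f : Matrix d c ℝ → ℝ} {Z G : Matrix d c ℝ} (hG : G ∈ T Z)
    (h : ∀ η ∈ T Z, metric M G η = fderiv ℝ f Z η) : riemannianGradient M T f Z = G := by
  have h' := Classical.epsilon_spec
    (p := fun G => G ∈ T Z ∧ ∀ η ∈ T Z, metric M G η = fderiv ℝ f Z η) ⟨G, hG, h⟩
  exact metric_eq_of_forall hM h'.1 hG fun ζ hζ => (h'.2 ζ hζ).trans (h ζ hζ).symm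

end Metric

/-! ### The Riemannian Hessian on a product of generalized Stiefel manifolds -/


lemma toRows₁_add {d₁ d₂ c : Type*} (Z W : Matrix (d₁ ⊕ d₂) c ℝ) :
    (Z + W).toRows₁ = Z.toRows₁ + W.toRows₁ := rfl

lemma toRows₂_add {d₁ d₂ c : Type*} (Z W : Matrix (d₁ ⊕ d₂) c ℝ) :
    (Z + W).toRows₂ = Z.toRows₂ + W.toRows₂ := rfl

lemma toRows₁_smul {d₁ d₂ c : Type*} (r : ℝ) (Z : Matrix (d₁ ⊕ d₂) c ℝ) :
    (r • Z).toRows₁ = r • Z.toRows₁ := rfl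

lemma toRows₂_smul {d₁ d₂ c : Type*} (r : ℝ) (Z : Matrix (d₁ ⊕ d₂) c ℝ) :
    (r • Z).toRows₂ = r • Z.toRows₂ := rfl

section Hessian

variable {d₁ d₂ : Type*} [Fintype d₁] [Fintype d₂] {p : ℕ}
  {B₁ : Matrix d₁ d₁ ℝ} {B₂ : Matrix d₂ d₂ ℝ}

/-- A nonsingular linear system that depends linearly on a parameter has a differentiable solution
near the parameter. -/
lemma exists_hasFDerivAt_solution {E F : Type*} [NormedAddCommGroup E] [NormedSpace ℝ E]
    [FiniteDimensional ℝ E] [NormedAddCommGroup F] [NormedSpace ℝ F] [FiniteDimensional ℝ F]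
    (K₀ : E →ₗ[ℝ] E) (K₁ : F →ₗ[ℝ] E →ₗ[ℝ] E) (r : F →ₗ[ℝ] E) (z : F)
    (hinj : ∀ x, K₀ x + K₁ z x = 0 → x = 0) :
    ∃ (s : F → E) (s' : F →L[ℝ] E), HasFDerivAt s s' z ∧
      (∀ᶠ y in nhds z, K₀ (s y) + K₁ y (s y) = r y) ∧
      ∀ ξ, K₀ (s' ξ) + K₁ z (s' ξ) + K₁ ξ (s z) = r ξ := by
  have : CompleteSpace E := FiniteDimensional.complete ℝ E
  let k₁ : F →L[ℝ] E →L[ℝ] E := LinearMap.toContinuousLinearMap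
    (LinearMap.toContinuousLinearMap.toLinearMap ∘ₗ K₁)
  let K : F → E →L[ℝ] E := fun y => LinearMap.toContinuousLinearMap K₀ + k₁ y
  have hKapp : ∀ y x, K y x = K₀ x + K₁ y x := fun y x => rfl
  have hK : HasFDerivAt K k₁ z := k₁.hasFDerivAt.const_add _
  have hunit : IsUnit (K z) := by
    rw [ContinuousLinearMap.isUnit_iff_bijective]
    have hi : Function.Injective (K z).toLinearMap :=
      (injective_iff_map_eq_zero _).2 fun x hx => hinj x hx
    exact ⟨hi, LinearMap.surjective_of_injective hi⟩
  let R : F →L[ℝ] E := LinearMap.toContinuousLinearMap r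
  let s : F → E := fun y => Ring.inverse (K y) (R y)
  have hs : DifferentiableAt ℝ s z :=
    ((differentiableAt_inverse hunit).comp z hK.differentiableAt).clm_apply R.differentiableAt
  have hev : ∀ᶠ y in nhds z, K y (s y) = R y := by
    have h1 : ∀ᶠ y in nhds z, IsUnit (K y) :=
      hK.continuousAt.eventually (Units.isOpen.mem_nhds hunit)
    filter_upwards [h1] with y hy
    have : (K y * Ring.inverse (K y)) (R y) = R y := by rw [Ring.mul_inverse_cancel _ hy]; rfl
    exact this
  refine ⟨s, fderiv ℝ s z, hs.hasFDerivAt, hev, fun ξ => ?_⟩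
  -- Both sides of `K y (s y) = R y` are differentiated at `z`; the product rule on the left gives
  -- the last claim.
  have h2 := (hK.clm_apply hs.hasFDerivAt).unique (R.hasFDerivAt.congr_of_eventuallyEq hev)
  exact DFunLike.congr_fun h2 ξ

/-- The combination of the constraint gradients at `Z` with multipliers `S₁`, `S₂`. -/
def multiplierTerm (B₁ : Matrix d₁ d₁ ℝ) (B₂ : Matrix d₂ d₂ ℝ) (Z : Matrix (d₁ ⊕ d₂) (Fin p) ℝ)
    (S₁ S₂ : Matrix (Fin p) (Fin p) ℝ) : Matrix (d₁ ⊕ d₂) (Fin p) ℝ :=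
  fromRows (B₁ * Z.toRows₁ * S₁) (B₂ * Z.toRows₂ * S₂)

lemma trace_transpose_mul_eq (η W : Matrix (d₁ ⊕ d₂) (Fin p) ℝ) :
    trace (ηᵀ * W) = trace (η.toRows₁ᵀ * W.toRows₁) + trace (η.toRows₂ᵀ * W.toRows₂) := by
  conv_lhs => rw [← fromRows_toRows η, ← fromRows_toRows W, transpose_fromRows,
    fromCols_mul_fromRows, trace_add]

lemma trace_mul_eq_zero_of_skew {A S : Matrix (Fin p) (Fin p) ℝ} (hA : A + Aᵀ = 0) (hS : Sᵀ = S) :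
    trace (A * S) = 0 := by
  have h1 : trace (A * S) = trace (Aᵀ * S) := by
    rw [← trace_transpose, transpose_mul, hS, trace_mul_comm]
  have h2 : trace (A * S) + trace (Aᵀ * S) = 0 := by
    rw [← trace_add, ← Matrix.add_mul, hA, Matrix.zero_mul, trace_zero]
  linarith

/-- The matrices `B * X * S` with `S` symmetric are Euclidean normals: tangency makes `ξᵀ * B * X`
skew, and a skew matrix is trace-orthogonal to a symmetric one. -/
lemma trace_tangent_mul {d : Type*} [Fintype d] {B : Matrix d d ℝ} (hB : Bᵀ = B)
    {X ξ : Matrix d (Fin p) ℝ} (hξ : ξ ∈ genStiefelTangent B X) {S : Matrix (Fin p) (Fin p) ℝ}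
    (hS : Sᵀ = S) : trace (ξᵀ * (B * X * S)) = 0 := by
  have hξ' : ξᵀ * B * X + Xᵀ * B * ξ = 0 := hξ
  rw [← Matrix.mul_assoc, ← Matrix.mul_assoc]
  refine trace_mul_eq_zero_of_skew ?_ hS
  rw [← hξ']
  simp [hB, Matrix.mul_assoc]

lemma trace_tangent_multiplierTerm (hB₁ : B₁ᵀ = B₁) (hB₂ : B₂ᵀ = B₂)
    {Z η : Matrix (d₁ ⊕ d₂) (Fin p) ℝ} (hη : η ∈ prodStiefelTangent B₁ B₂ Z)
    {S₁ S₂ : Matrix (Fin p) (Fin p) ℝ} (hS₁ : S₁ᵀ = S₁) (hS₂ : S₂ᵀ = S₂) :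
    trace (ηᵀ * multiplierTerm B₁ B₂ Z S₁ S₂) = 0 := by
  rw [trace_transpose_mul_eq, multiplierTerm, toRows₁_fromRows, toRows₂_fromRows,
    trace_tangent_mul hB₁ hη.1 hS₁, trace_tangent_mul hB₂ hη.2 hS₂, add_zero]

/-- The space of pairs of a tangent vector and multipliers. -/
abbrev SystemSpace (d₁ d₂ : Type*) (p : ℕ) : Type _ :=
  Matrix (d₁ ⊕ d₂) (Fin p) ℝ × Matrix (Fin p) (Fin p) ℝ × Matrix (Fin p) (Fin p) ℝ

/-- The part of the linear system for gradient and multipliers that depends on `Z`. -/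
noncomputable def systemVar (B₁ : Matrix d₁ d₁ ℝ) (B₂ : Matrix d₂ d₂ ℝ) (p : ℕ) :
    Matrix (d₁ ⊕ d₂) (Fin p) ℝ →ₗ[ℝ] SystemSpace d₁ d₂ p →ₗ[ℝ] SystemSpace d₁ d₂ p :=
  LinearMap.mk₂ ℝ
    -- Multipliers range over all square matrices, which keeps the system square. Only their
    -- symmetric part enters the first equation; the skew part is controlled by `systemConst`.
    (fun Z x => (multiplierTerm B₁ B₂ Z (x.2.1 + x.2.1ᵀ) (x.2.2 + x.2.2ᵀ),
      x.1.toRows₁ᵀ * B₁ * Z.toRows₁ + Z.toRows₁ᵀ * B₁ * x.1.toRows₁,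
      x.1.toRows₂ᵀ * B₂ * Z.toRows₂ + Z.toRows₂ᵀ * B₂ * x.1.toRows₂))
    (by
      intro Z Z' x
      refine Prod.ext ?_ (Prod.ext ?_ ?_)
      · ext (i | i) j <;>
          simp [multiplierTerm, toRows₁_add, toRows₂_add, Matrix.mul_add, Matrix.add_mul] <;> ring
      · simp only [toRows₁_add, Prod.snd_add, Prod.fst_add, transpose_add, Matrix.mul_add,
          Matrix.add_mul]
        abel
      · simp only [toRows₂_add, Prod.snd_add, transpose_add, Matrix.mul_add, Matrix.add_mul]
        abel)
    (by
      intro c Z x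
      refine Prod.ext ?_ (Prod.ext ?_ ?_)
      · ext (i | i) j <;> simp [multiplierTerm, toRows₁_smul, toRows₂_smul]
      · simp [toRows₁_smul]
      · simp [toRows₂_smul])
    (by
      intro Z x y
      refine Prod.ext ?_ (Prod.ext ?_ ?_)
      · ext (i | i) j <;> simp [multiplierTerm, Matrix.mul_add] <;> ring
      · simp only [toRows₁_add, Prod.snd_add, Prod.fst_add, transpose_add, Matrix.mul_add,
          Matrix.add_mul]
        abel
      · simp only [toRows₂_add, Prod.snd_add, Prod.fst_add, transpose_add, Matrix.mul_add,
          Matrix.add_mul]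
        abel)
    (by
      intro c Z x
      refine Prod.ext ?_ (Prod.ext ?_ ?_)
      · ext (i | i) j <;> simp [multiplierTerm, ← smul_add]
      · simp [toRows₁_smul]
      · simp [toRows₂_smul])

/-- The part of the linear system for gradient and multipliers that does not depend on `Z`. -/
noncomputable def systemConst (M : Matrix (d₁ ⊕ d₂) (d₁ ⊕ d₂) ℝ) (p : ℕ) :
    SystemSpace d₁ d₂ p →ₗ[ℝ] SystemSpace d₁ d₂ p where
  toFun x := (M * x.1, x.2.1 - x.2.1ᵀ, x.2.2 - x.2.2ᵀ)
  map_add' x y := by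
    refine Prod.ext ?_ (Prod.ext ?_ ?_)
    · simp [Matrix.mul_add]
    · simp only [Prod.snd_add, Prod.fst_add, transpose_add]
      abel
    · simp only [Prod.snd_add, transpose_add]
      abel
  map_smul' c x := by simp [smul_sub]

end Hessian


/-! ### Gradient and Hessian from the linear system for tangent vectors and multipliers -/

section Hessian

variable {d₁ d₂ : Type*} [Fintype d₁] [Fintype d₂] {p : ℕ}
  {B₁ : Matrix d₁ d₁ ℝ} {B₂ : Matrix d₂ d₂ ℝ} {M : Matrix (d₁ ⊕ d₂) (d₁ ⊕ d₂) ℝ}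

/-- Separating skew and symmetric parts lets one matrix equation encode both the tangency condition
and the symmetry of the multiplier. -/
lemma eq_zero_of_skew_add_symm {A S : Matrix (Fin p) (Fin p) ℝ} (hA : Aᵀ = A)
    (h : S - Sᵀ + A = 0) : A = 0 ∧ S = Sᵀ := by
  have h' : Sᵀ - S + A = 0 := by
    have := congrArg transpose h
    simpa [hA] using this
  have hA0 : A = 0 := by
    ext i j
    have h1 := congrFun (congrFun h i) j
    have h2 := congrFun (congrFun h' i) j
    simp only [Matrix.add_apply, Matrix.sub_apply, Matrix.zero_apply] at h1 h2 ⊢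
    linarith
  refine ⟨hA0, ?_⟩
  rwa [hA0, add_zero, sub_eq_zero] at h

lemma symm_tangentMap {d : Type*} [Fintype d] {B : Matrix d d ℝ} (hB : Bᵀ = B)
    (X ξ : Matrix d (Fin p) ℝ) :
    (ξᵀ * B * X + Xᵀ * B * ξ)ᵀ = ξᵀ * B * X + Xᵀ * B * ξ := by
  simp only [transpose_add, transpose_mul, transpose_transpose, hB, Matrix.mul_assoc]
  rw [add_comm]

lemma system_apply (Z : Matrix (d₁ ⊕ d₂) (Fin p) ℝ) (x : SystemSpace d₁ d₂ p) :
    systemConst M p x + systemVar B₁ B₂ p Z x =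
      (M * x.1 + multiplierTerm B₁ B₂ Z (x.2.1 + x.2.1ᵀ) (x.2.2 + x.2.2ᵀ),
        x.2.1 - x.2.1ᵀ + (x.1.toRows₁ᵀ * B₁ * Z.toRows₁ + Z.toRows₁ᵀ * B₁ * x.1.toRows₁),
        x.2.2 - x.2.2ᵀ + (x.1.toRows₂ᵀ * B₂ * Z.toRows₂ + Z.toRows₂ᵀ * B₂ * x.1.toRows₂)) := rfl

lemma system_solution (hB₁ : B₁ᵀ = B₁) (hB₂ : B₂ᵀ = B₂) {Z W : Matrix (d₁ ⊕ d₂) (Fin p) ℝ}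
    {x : SystemSpace d₁ d₂ p} (h : systemConst M p x + systemVar B₁ B₂ p Z x = (W, 0, 0)) :
    x.1 ∈ prodStiefelTangent B₁ B₂ Z ∧ x.2.1 = x.2.1ᵀ ∧ x.2.2 = x.2.2ᵀ ∧
      M * x.1 + multiplierTerm B₁ B₂ Z (x.2.1 + x.2.1ᵀ) (x.2.2 + x.2.2ᵀ) = W := by
  rw [system_apply] at h
  simp only [Prod.mk.injEq] at h
  obtain ⟨h₁, h₂, h₃⟩ := h
  have h₂' := eq_zero_of_skew_add_symm (symm_tangentMap hB₁ _ _) h₂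
  have h₃' := eq_zero_of_skew_add_symm (symm_tangentMap hB₂ _ _) h₃
  exact ⟨⟨h₂'.1, h₃'.1⟩, h₂'.2, h₃'.2, h₁⟩

/-- Pairing with a tangent `η` removes the multipliers. `G` itself need not be tangent, so this also
applies to the derivative of the gradient. -/
lemma trace_metric_of_system (hM : M.PosDef) (hB₁ : B₁ᵀ = B₁) (hB₂ : B₂ᵀ = B₂)
    {Z W G η : Matrix (d₁ ⊕ d₂) (Fin p) ℝ} {S₁ S₂ : Matrix (Fin p) (Fin p) ℝ}
    (h : M * G + multiplierTerm B₁ B₂ Z (S₁ + S₁ᵀ) (S₂ + S₂ᵀ) = W)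
    (hη : η ∈ prodStiefelTangent B₁ B₂ Z) : metric M G η = trace (ηᵀ * W) := by
  rw [← h, Matrix.mul_add, trace_add, trace_tangent_multiplierTerm hB₁ hB₂ hη, add_zero,
    metric_comm hM, metric, Matrix.mul_assoc]
  · simp [add_comm]
  · simp [add_comm]

lemma eq_zero_of_mul_eq_zero {d : Type*} [Fintype d] {B : Matrix d d ℝ}
    {X : Matrix d (Fin p) ℝ} (hX : X ∈ genStiefel B p) {S : Matrix (Fin p) (Fin p) ℝ}
    (h : B * X * (S + Sᵀ) = 0) (hS : S = Sᵀ) : S = 0 := by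
  have hX' : Xᵀ * B * X = 1 := hX
  have h' : Xᵀ * (B * X * (S + Sᵀ)) = 0 := by rw [h, Matrix.mul_zero]
  rw [← Matrix.mul_assoc, ← Matrix.mul_assoc, hX', Matrix.one_mul, ← hS] at h'
  ext i j
  have := congrFun (congrFun h' i) j
  simp only [Matrix.add_apply, Matrix.zero_apply] at this ⊢
  linarith

/-- For zero right-hand side the tangent component has zero length, and multiplying the rest by `Xᵀ`
with `Xᵀ * B * X = 1` annihilates the multipliers. -/
lemma system_injective (hM : M.PosDef) (hB₁ : B₁ᵀ = B₁) (hB₂ : B₂ᵀ = B₂)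
    {Z : Matrix (d₁ ⊕ d₂) (Fin p) ℝ} (hZ : Z ∈ prodStiefel B₁ B₂ p) (x : SystemSpace d₁ d₂ p)
    (h : systemConst M p x + systemVar B₁ B₂ p Z x = 0) : x = 0 := by
  obtain ⟨hT, h₁, h₂, h₃⟩ := system_solution hB₁ hB₂ (W := 0) h
  have hG : x.1 = 0 := by
    by_contra hne
    have := metric_pos hM hne
    rw [trace_metric_of_system hM hB₁ hB₂ h₃ hT] at this
    simp at this
  rw [hG, Matrix.mul_zero, zero_add] at h₃
  have e₁ : B₁ * Z.toRows₁ * (x.2.1 + x.2.1ᵀ) = 0 := by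
    have := congrArg toRows₁ h₃
    rwa [multiplierTerm, toRows₁_fromRows] at this
  have e₂ : B₂ * Z.toRows₂ * (x.2.2 + x.2.2ᵀ) = 0 := by
    have := congrArg toRows₂ h₃
    rwa [multiplierTerm, toRows₂_fromRows] at this
  exact Prod.ext hG (Prod.ext (eq_zero_of_mul_eq_zero hZ.1 e₁ h₁)
    (eq_zero_of_mul_eq_zero hZ.2 e₂ h₂))

/-- The Riemannian Hessian at a critical point of a function with linear Euclidean gradient `L`:
the Euclidean Hessian corrected by the Lagrange multipliers `D₁`, `D₂`. -/
theorem riemannianHessian_spec (hM : M.PosDef) (hB₁ : B₁ᵀ = B₁) (hB₂ : B₂ᵀ = B₂)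
    {f : Matrix (d₁ ⊕ d₂) (Fin p) ℝ → ℝ}
    {L : Matrix (d₁ ⊕ d₂) (Fin p) ℝ →ₗ[ℝ] Matrix (d₁ ⊕ d₂) (Fin p) ℝ}
    (hf : ∀ Z η, fderiv ℝ f Z η = trace (ηᵀ * L Z))
    {Z : Matrix (d₁ ⊕ d₂) (Fin p) ℝ} (hZ : Z ∈ prodStiefel B₁ B₂ p)
    {D₁ D₂ : Matrix (Fin p) (Fin p) ℝ} (hD₁ : D₁ᵀ = D₁) (hD₂ : D₂ᵀ = D₂)
    (hcrit : L Z = multiplierTerm B₁ B₂ Z D₁ D₂) (ξ : Matrix (d₁ ⊕ d₂) (Fin p) ℝ) :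
    riemannianHessian M (prodStiefelTangent B₁ B₂) f Z ξ ∈ prodStiefelTangent B₁ B₂ Z ∧
      ∀ η ∈ prodStiefelTangent B₁ B₂ Z,
        metric M (riemannianHessian M (prodStiefelTangent B₁ B₂) f Z ξ) η =
          trace (ηᵀ * (L ξ - multiplierTerm B₁ B₂ ξ D₁ D₂)) := by
  have hinj := system_injective hM hB₁ hB₂ hZ
  obtain ⟨s, s', hs, hev, hder⟩ := exists_hasFDerivAt_solution (systemConst M p)
    (systemVar B₁ B₂ p) (LinearMap.inl ℝ _ _ ∘ₗ L) Z hinj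
  -- The system is solved on a full ambient neighbourhood, so near `Z` the gradient field agrees
  -- with a component of a differentiable map, off the manifold as well.
  have hgrad : riemannianGradient M (prodStiefelTangent B₁ B₂) f =ᶠ[nhds Z] fun y => (s y).1 := by
    filter_upwards [hev] with y hy
    obtain ⟨hT, -, -, h₃⟩ := system_solution hB₁ hB₂ (W := L y) hy
    exact riemannianGradient_eq hM hT fun η hη => by
      rw [hf, trace_metric_of_system hM hB₁ hB₂ h₃ hη]
  have hfd : fderiv ℝ (riemannianGradient M (prodStiefelTangent B₁ B₂) f) Z ξ = (s' ξ).1 := by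
    have hs₁ : HasFDerivAt (fun y => (s y).1)
        ((ContinuousLinearMap.fst ℝ (Matrix (d₁ ⊕ d₂) (Fin p) ℝ)
          (Matrix (Fin p) (Fin p) ℝ × Matrix (Fin p) (Fin p) ℝ)).comp s') Z := hs.fst
    exact DFunLike.congr_fun (hs₁.congr_of_eventuallyEq hgrad).fderiv ξ
  have hdouble : ∀ D : Matrix (Fin p) (Fin p) ℝ, Dᵀ = D →
      (1 / 2 : ℝ) • D + ((1 / 2 : ℝ) • D)ᵀ = D := by
    intro D hD
    rw [transpose_smul, hD, ← add_smul]
    norm_num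
  -- At the critical point the gradient vanishes. The system contains `S + Sᵀ`, hence the halved
  -- multipliers.
  have hsZ : s Z = (0, (1 / 2 : ℝ) • D₁, (1 / 2 : ℝ) • D₂) := by
    rw [← sub_eq_zero]
    apply hinj
    rw [map_sub, map_sub, sub_add_sub_comm, hev.self_of_nhds, system_apply]
    simp only [hdouble _ hD₁, hdouble _ hD₂, ← hcrit]
    have z₁ : toRows₁ (0 : Matrix (d₁ ⊕ d₂) (Fin p) ℝ) = 0 := rfl
    have z₂ : toRows₂ (0 : Matrix (d₁ ⊕ d₂) (Fin p) ℝ) = 0 := rfl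
    simp [hD₁, hD₂, z₁, z₂]
  -- The differentiated system: moving the constraint normals in direction `ξ` produces the
  -- correction `multiplierTerm B₁ B₂ ξ D₁ D₂`.
  have h₁ : systemConst M p (s' ξ) + systemVar B₁ B₂ p Z (s' ξ) =
      (L ξ, 0, 0) - systemVar B₁ B₂ p ξ (s Z) := eq_sub_of_add_eq (hder ξ)
  have h₂ : M * (s' ξ).1 + multiplierTerm B₁ B₂ Z ((s' ξ).2.1 + (s' ξ).2.1ᵀ)
      ((s' ξ).2.2 + (s' ξ).2.2ᵀ) = L ξ - multiplierTerm B₁ B₂ ξ D₁ D₂ := by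
    have := congrArg Prod.fst h₁
    rw [hsZ, system_apply] at this
    simpa only [systemVar, LinearMap.mk₂_apply, Prod.fst_sub, hdouble _ hD₁, hdouble _ hD₂]
      using this
  obtain ⟨hT, hproj⟩ := proj_spec hM (prodStiefelTangent B₁ B₂ Z)
    (fderiv ℝ (riemannianGradient M (prodStiefelTangent B₁ B₂) f) Z ξ)
  refine ⟨hT, fun η hη => ?_⟩
  rw [riemannianHessian, hproj η hη, hfd, trace_metric_of_system hM hB₁ hB₂ h₂ hη]

/-- The eigenvalues of the Riemannian Hessian are those of a bilinear form that represents it on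
the tangent space. -/
theorem riemannianHessianEigenvalues_eq {d c : Type*} [Fintype d] [Fintype c] {M : Matrix d d ℝ}
    (hM : M.PosDef) {T : Matrix d c ℝ → Submodule ℝ (Matrix d c ℝ)} {f : Matrix d c ℝ → ℝ}
    {Z : Matrix d c ℝ} {H : LinearMap.BilinForm ℝ (Matrix d c ℝ)}
    (h : ∀ ξ, riemannianHessian M T f Z ξ ∈ T Z ∧
      ∀ η ∈ T Z, metric M (riemannianHessian M T f Z ξ) η = H ξ η) :
    riemannianHessianEigenvalues M T f Z = formEigenvalues (T Z) H (metricForm M) := by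
  ext l
  refine exists_congr fun ξ => and_congr_right fun hξ => and_congr_right fun _ => ?_
  constructor
  · intro hl η hη
    rw [← (h ξ).2 η hη, hl, ← metricForm_apply, map_smul, LinearMap.smul_apply, smul_eq_mul]
  · intro hl
    refine metric_eq_of_forall hM (h ξ).1 ((T Z).smul_mem l hξ) fun η hη => ?_
    rw [(h ξ).2 η hη, hl η hη, ← metricForm_apply, map_smul, LinearMap.smul_apply, smul_eq_mul]

end Hessian


/-! ### Orthogonal matrices and trace maximization -/

section Trace

/-- An orthogonally sorted spectral decomposition of a real symmetric matrix. -/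
lemma exists_orthogonal_diagonalization {m : ℕ} {A : Matrix (Fin m) (Fin m) ℝ} (hA : Aᵀ = A) :
    ∃ (R : Matrix (Fin m) (Fin m) ℝ) (d : Fin m → ℝ),
      Rᵀ * R = 1 ∧ Rᵀ * A * R = diagonal d ∧ Antitone d := by
  have hA' : A.IsHermitian := by simpa [IsHermitian] using hA
  let Q : Matrix (Fin m) (Fin m) ℝ := hA'.eigenvectorUnitary
  have hQ : Qᵀ * Q = 1 := by
    have := Unitary.coe_star_mul_self hA'.eigenvectorUnitary
    simpa [star_eq_conjTranspose] using this
  have hQA : Qᵀ * A * Q = diagonal hA'.eigenvalues := by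
    have := hA'.conjStarAlgAut_star_eigenvectorUnitary
    rw [Unitary.conjStarAlgAut_star_apply] at this
    simpa [star_eq_conjTranspose, Function.comp_def] using this
  let e : Equiv.Perm (Fin m) := Tuple.sort fun i => -hA'.eigenvalues i
  have hmono : Monotone ((fun i => -hA'.eigenvalues i) ∘ e) := Tuple.monotone_sort _
  refine ⟨Q.submatrix id e, hA'.eigenvalues ∘ e, ?_, ?_, ?_⟩
  · have : (Qᵀ * Q).submatrix e e = 1 := by rw [hQ, submatrix_one_equiv]
    rw [← this]
    ext i j
    simp [mul_apply]
  · rw [← submatrix_diagonal_equiv, ← hQA]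
    ext i j
    simp [mul_apply]
  · intro i j hij
    have := hmono hij
    simpa using this

/-- Plane rotations in algebraic form: `D` plays the projection onto a coordinate plane and `J` the
quarter turn in it. -/
lemma rotation_orthogonal {A : Type*} [Ring A] [Algebra ℝ A] {D J : A} (hD : D * D = D)
    (hDJ : D * J = J) (hJD : J * D = J) (hJ : J * J = -D) {c s : ℝ} (h : c ^ 2 + s ^ 2 = 1) :
    (1 + (c - 1) • D - s • J) * (1 + (c - 1) • D + s • J) = 1 := by
  simp only [mul_add, sub_mul, add_mul, mul_one, one_mul, smul_mul_smul_comm, hD, hDJ, hJD, hJ]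
  match_scalars
  · ring
  · linear_combination h
  · ring

/-- On the unit circle `c * a + s * b` has maximum `√(a² + b²)`, reached at `(a, b) / r`; it can
equal `a` only if `b = 0`. -/
lemma eq_zero_of_rotation_le {a b : ℝ} (h : ∀ c s : ℝ, c ^ 2 + s ^ 2 = 1 → c * a + s * b ≤ a) :
    b = 0 := by
  by_contra hb
  have hpos : 0 < a ^ 2 + b ^ 2 := by positivity
  have hr := Real.sq_sqrt hpos.le
  have hr0 := Real.sqrt_pos.2 hpos
  set r := √(a ^ 2 + b ^ 2)
  have h1 := h (a / r) (b / r) (by field_simp; linarith)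
  have h2 : a / r * a + b / r * b = r := by field_simp; linarith
  rw [h2] at h1
  have : 0 < b ^ 2 := by positivity
  nlinarith

variable {n : Type*} [Fintype n] [DecidableEq n]

/-- If the identity maximizes `tr (R G)` over orthogonal matrices `R`, then `G` is symmetric with
nonnegative diagonal. -/
lemma symm_of_trace_le {G : Matrix n n ℝ}
    (h : ∀ R : Matrix n n ℝ, Rᵀ * R = 1 → trace (R * G) ≤ trace G) :
    (∀ i j, G i j = G j i) ∧ ∀ i, 0 ≤ G i i := by
  constructor
  · intro i j
    rcases eq_or_ne i j with rfl | hij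
    · rfl
    have hji := hij.symm
    -- Testing with the rotation of the plane of `i` and `j`: the first-order term in the angle is
    -- `G j i - G i j`.
    have key : G j i - G i j = 0 := by
      refine eq_zero_of_rotation_le (a := G i i + G j j) fun c s hcs => ?_
      let D : Matrix n n ℝ := single i i 1 + single j j 1
      let J : Matrix n n ℝ := single i j 1 - single j i 1
      have hD : D * D = D := by
        simp [D, Matrix.add_mul, Matrix.mul_add, single_mul_single_of_ne, hij, hji]
      have hDJ : D * J = J := by
        simp [D, J, Matrix.add_mul, Matrix.mul_sub, single_mul_single_of_ne, hij, hji]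
      have hJD : J * D = J := by
        simp [D, J, Matrix.sub_mul, Matrix.mul_add, single_mul_single_of_ne, hij, hji]
        abel
      have hJ : J * J = -D := by
        simp [D, J, Matrix.sub_mul, Matrix.mul_sub, single_mul_single_of_ne, hij, hji]
        abel
      have hDt : Dᵀ = D := by simp [D]
      have hJt : Jᵀ = -J := by simp [J]
      have := h (1 + (c - 1) • D + s • J) (by
        rw [transpose_add, transpose_add, transpose_one, transpose_smul, transpose_smul, hDt, hJt,
          smul_neg, ← sub_eq_add_neg, rotation_orthogonal hD hDJ hJD hJ hcs])
      simp only [D, J, Matrix.add_mul, Matrix.sub_mul, trace_add, trace_sub, Matrix.smul_mul,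
        trace_smul, smul_eq_mul, trace_single_mul, one_mul] at this
      linarith
    linarith
  · intro i
    -- The reflection in coordinate `i` lowers the trace by `2 * G i i`.
    have := h (1 - (2 : ℝ) • single i i 1) (by
      have hE : single i i (1 : ℝ) * single i i 1 = single i i 1 := by simp
      rw [transpose_sub, transpose_one, transpose_smul, transpose_single, sub_mul, mul_sub, mul_sub,
        smul_mul_smul_comm, hE, mul_one, mul_one, one_mul]
      module)
    simp [Matrix.sub_mul, trace_sub, trace_single_mul] at this
    linarith

/-! ### Trace maximization over matrices with orthonormal columns -/

lemma isCompact_orthonormal (a m : ℕ) :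
    IsCompact {o : Matrix (Fin a) (Fin m) ℝ | oᵀ * o = 1} := by
  have hK : IsCompact (Set.pi Set.univ fun _ : Fin a => Set.pi Set.univ
      fun _ : Fin m => Set.Icc (-1 : ℝ) 1) :=
    isCompact_univ_pi fun _ => isCompact_univ_pi fun _ => isCompact_Icc
  refine IsCompact.of_isClosed_subset hK ?_ ?_
  · have hc : Continuous fun o : Matrix (Fin a) (Fin m) ℝ => oᵀ * o :=
      (continuous_id.matrix_transpose).matrix_mul continuous_id
    exact isClosed_singleton.preimage hc
  · intro o ho i _ k _
    have h1 : ∑ j, o j k * o j k = 1 := by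
      have := congrFun (congrFun (show oᵀ * o = 1 from ho) k) k
      simpa [mul_apply] using this
    have h2 : o i k * o i k ≤ 1 := h1 ▸ Finset.single_le_sum
      (f := fun j => o j k * o j k) (fun j _ => mul_self_nonneg _) (Finset.mem_univ i)
    exact abs_le.1 (abs_le_one_iff_mul_self_le_one.2 h2)

/-- The matrix of the first `m` standard basis vectors. -/
def frame (a m : ℕ) : Matrix (Fin a) (Fin m) ℝ :=
  of fun i k => if (i : ℕ) = k then 1 else 0

lemma frame_apply (a m : ℕ) (i : Fin a) (k : Fin m) :
    frame a m i k = if (i : ℕ) = k then 1 else 0 := rfl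

lemma mul_frame_apply {ι : Type*} {a m : ℕ} (h : m ≤ a) (A : Matrix ι (Fin a) ℝ) (i : ι)
    (k : Fin m) : (A * frame a m) i k = A i (Fin.castLE h k) := by
  rw [mul_apply, Finset.sum_eq_single (Fin.castLE h k)]
  · simp [frame_apply]
  · intro j _ hj
    have : (j : ℕ) ≠ k := fun he => hj (Fin.ext he)
    simp [frame_apply, this]
  · simp

lemma frame_transpose_mul_apply {ι : Type*} {a m : ℕ} (h : m ≤ a) (A : Matrix (Fin a) ι ℝ)
    (k : Fin m) (j : ι) : ((frame a m)ᵀ * A) k j = A (Fin.castLE h k) j := by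
  have := mul_frame_apply h Aᵀ j k
  rwa [← transpose_apply (Aᵀ * frame a m), transpose_mul, transpose_transpose] at this

lemma frame_orthonormal {a m : ℕ} (h : m ≤ a) : (frame a m)ᵀ * frame a m = 1 := by
  ext k l
  rw [frame_transpose_mul_apply h, frame_apply, one_apply]
  simp [Fin.ext_iff]

lemma exists_trace_max {a b m : ℕ} (ha : m ≤ a) (hb : m ≤ b) (A : Matrix (Fin a) (Fin b) ℝ) :
    ∃ (o₁ : Matrix (Fin a) (Fin m) ℝ) (o₂ : Matrix (Fin b) (Fin m) ℝ),
      o₁ᵀ * o₁ = 1 ∧ o₂ᵀ * o₂ = 1 ∧ ∀ (q₁ : Matrix (Fin a) (Fin m) ℝ)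
        (q₂ : Matrix (Fin b) (Fin m) ℝ), q₁ᵀ * q₁ = 1 → q₂ᵀ * q₂ = 1 →
          trace (q₁ᵀ * A * q₂) ≤ trace (o₁ᵀ * A * o₂) := by
  have hc : Continuous fun o : Matrix (Fin a) (Fin m) ℝ × Matrix (Fin b) (Fin m) ℝ =>
      trace (o.1ᵀ * A * o.2) :=
    ((continuous_fst.matrix_transpose.matrix_mul continuous_const).matrix_mul
      continuous_snd).matrix_trace
  have hK := (isCompact_orthonormal a m).prod (isCompact_orthonormal b m)
  have hne : ({o : Matrix (Fin a) (Fin m) ℝ | oᵀ * o = 1} ×ˢ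
      {o : Matrix (Fin b) (Fin m) ℝ | oᵀ * o = 1}).Nonempty :=
    ⟨(frame a m, frame b m), frame_orthonormal ha, frame_orthonormal hb⟩
  obtain ⟨o, ho, hmax⟩ := hK.exists_isMaxOn hne hc.continuousOn
  exact ⟨o.1, o.2, ho.1, ho.2, fun q₁ q₂ h₁ h₂ => isMaxOn_iff.1 hmax (q₁, q₂) ⟨h₁, h₂⟩⟩

/-- There is a maximizer of `tr (o₁ᵀ A o₂)` over matrices with orthonormal columns for which
`o₁ᵀ A o₂` is diagonal with non-increasing diagonal. -/
lemma exists_diagonal_trace_max {a b m : ℕ} (ha : m ≤ a) (hb : m ≤ b)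
    (A : Matrix (Fin a) (Fin b) ℝ) :
    ∃ (o₁ : Matrix (Fin a) (Fin m) ℝ) (o₂ : Matrix (Fin b) (Fin m) ℝ) (d : Fin m → ℝ),
      o₁ᵀ * o₁ = 1 ∧ o₂ᵀ * o₂ = 1 ∧ o₁ᵀ * A * o₂ = diagonal d ∧ Antitone d ∧
      ∀ (q₁ : Matrix (Fin a) (Fin m) ℝ) (q₂ : Matrix (Fin b) (Fin m) ℝ),
        q₁ᵀ * q₁ = 1 → q₂ᵀ * q₂ = 1 → trace (q₁ᵀ * A * q₂) ≤ trace (o₁ᵀ * A * o₂) := by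
  obtain ⟨o₁, o₂, h₁, h₂, hmax⟩ := exists_trace_max ha hb A
  -- Rotating only `o₁` keeps the constraints, so maximality makes `o₁ᵀ * A * o₂` symmetric.
  -- Conjugating both frames by its eigenvectors then diagonalizes it without changing the trace.
  have hsymm := (symm_of_trace_le (G := o₁ᵀ * A * o₂) fun R hR => by
    have hR' : R * Rᵀ = 1 := mul_eq_one_comm.1 hR
    have := hmax (o₁ * Rᵀ) o₂ (by
      rw [transpose_mul, transpose_transpose, Matrix.mul_assoc, ← Matrix.mul_assoc o₁ᵀ, h₁,
        Matrix.one_mul, hR']) h₂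
    simpa [transpose_mul, Matrix.mul_assoc] using this).1
  obtain ⟨R, d, hR, hRd, hd⟩ := exists_orthogonal_diagonalization
    (A := o₁ᵀ * A * o₂) (by ext i j; exact hsymm j i)
  have hR' : R * Rᵀ = 1 := mul_eq_one_comm.1 hR
  have horth : ∀ {c : ℕ} (o : Matrix (Fin c) (Fin m) ℝ), oᵀ * o = 1 → (o * R)ᵀ * (o * R) = 1 := by
    intro c o ho
    rw [transpose_mul, Matrix.mul_assoc, ← Matrix.mul_assoc oᵀ, ho, Matrix.one_mul, hR]
  have hW : (o₁ * R)ᵀ * A * (o₂ * R) = Rᵀ * (o₁ᵀ * A * o₂) * R := by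
    simp only [transpose_mul, Matrix.mul_assoc]
  refine ⟨o₁ * R, o₂ * R, d, horth o₁ h₁, horth o₂ h₂, hW.trans hRd, hd, fun q₁ q₂ hq₁ hq₂ => ?_⟩
  rw [hW, trace_mul_cycle Rᵀ, hR', Matrix.one_mul]
  exact hmax q₁ q₂ hq₁ hq₂

end Trace


/-! ### Canonical bases -/

section Bases

lemma mul_transpose_mul_eq_one {d : ℕ} {B P : Matrix (Fin d) (Fin d) ℝ} (h : Pᵀ * B * P = 1) :
    P * (Pᵀ * B) = 1 :=
  mul_eq_one_comm.1 h

lemma mul_mul_transpose_eq_one {d : ℕ} {B P : Matrix (Fin d) (Fin d) ℝ} (h : Pᵀ * B * P = 1) :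
    B * P * Pᵀ = 1 := by
  rw [Matrix.mul_assoc] at h
  exact mul_eq_one_comm.1 h

/-- Eigenvectors of `B` scaled by the inverse square roots of the eigenvalues. -/
lemma exists_basis {d : ℕ} {B : Matrix (Fin d) (Fin d) ℝ} (hB : B.PosDef) :
    ∃ P : Matrix (Fin d) (Fin d) ℝ, Pᵀ * B * P = 1 := by
  obtain ⟨R, e, hR, hRe, -⟩ := exists_orthogonal_diagonalization (A := B)
    (by simpa using hB.isHermitian.eq)
  have he : ∀ i, 0 < e i := by
    have hinj : Function.Injective R.mulVec := by
      intro v w hvw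
      have := congrArg (Rᵀ *ᵥ ·) hvw
      simpa [mulVec_mulVec, hR] using this
    have hpd := hB.conjTranspose_mul_mul_same hinj
    rw [conjTranspose_eq_transpose_of_trivial, hRe] at hpd
    intro i
    simpa using hpd.diag_pos (i := i)
  refine ⟨R * diagonal fun i => (√(e i))⁻¹, ?_⟩
  have : (R * diagonal fun i => (√(e i))⁻¹)ᵀ * B * (R * diagonal fun i => (√(e i))⁻¹) =
      diagonal (fun i => (√(e i))⁻¹) * (Rᵀ * B * R) * diagonal fun i => (√(e i))⁻¹ := by
    simp only [transpose_mul, diagonal_transpose, Matrix.mul_assoc]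
  rw [this, hRe, diagonal_mul_diagonal, diagonal_mul_diagonal, ← diagonal_one]
  congr 1
  ext i
  have h1 := Real.sq_sqrt (he i).le
  have h2 := Real.sqrt_pos.2 (he i)
  field_simp
  linarith

lemma exists_orthogonal_extension {d m : ℕ} (h : m ≤ d) {W : Matrix (Fin d) (Fin m) ℝ}
    (hW : Wᵀ * W = 1) :
    ∃ O : Matrix (Fin d) (Fin d) ℝ, Oᵀ * O = 1 ∧ ∀ i k, O i (Fin.castLE h k) = W i k := by
  let v : Fin d → EuclideanSpace ℝ (Fin d) := fun j =>
    if hj : (j : ℕ) < m then WithLp.toLp 2 fun i => W i ⟨j, hj⟩ else 0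
  have hv : Orthonormal ℝ (Set.domRestrict {j : Fin d | (j : ℕ) < m} v) := by
    rw [orthonormal_iff_ite]
    rintro ⟨i, hi⟩ ⟨j, hj⟩
    have hi' : (i : ℕ) < m := hi
    have hj' : (j : ℕ) < m := hj
    have := congrFun (congrFun hW ⟨j, hj⟩) ⟨i, hi⟩
    simp only [mul_apply, transpose_apply, one_apply, Fin.mk.injEq] at this
    simp only [Set.domRestrict_apply, v, hi', hj', dif_pos, PiLp.inner_apply, Subtype.mk.injEq]
    simp only [RCLike.inner_apply, conj_trivial, Fin.ext_iff]
    rw [this]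
    simp only [eq_comm]
  obtain ⟨b, hb⟩ := hv.exists_orthonormalBasis_extension_of_card_eq (by simp)
  refine ⟨of fun i j => b j i, ?_, fun i k => ?_⟩
  · ext i j
    have := orthonormal_iff_ite.1 b.orthonormal j i
    simp only [PiLp.inner_apply, RCLike.inner_apply, conj_trivial] at this
    simp only [mul_apply, transpose_apply, of_apply, one_apply]
    rw [this]
    simp only [eq_comm]
  · have := hb (Fin.castLE h k) (by simp)
    simp [of_apply, this, v]

/-- A family of `B`-orthonormal columns extends to a `B`-orthonormal basis. -/
lemma exists_basis_extension {d m : ℕ} (h : m ≤ d) {B : Matrix (Fin d) (Fin d) ℝ}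
    (hB : B.PosDef) {U : Matrix (Fin d) (Fin m) ℝ} (hU : Uᵀ * B * U = 1) :
    ∃ P : Matrix (Fin d) (Fin d) ℝ, Pᵀ * B * P = 1 ∧ U = P * frame d m := by
  obtain ⟨P₀, hP₀⟩ := exists_basis hB
  have hBt : Bᵀ = B := by simpa using hB.isHermitian.eq
  have h1 := mul_transpose_mul_eq_one hP₀
  have h2 := mul_mul_transpose_eq_one hP₀
  -- In the coordinates of `P₀`, the columns of `U` become orthonormal in the Euclidean sense.
  obtain ⟨O, hO, hOW⟩ := exists_orthogonal_extension h (W := P₀ᵀ * B * U) (by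
    rw [transpose_mul, transpose_mul, transpose_transpose, hBt]
    calc Uᵀ * (B * P₀) * (P₀ᵀ * B * U) = Uᵀ * (B * P₀ * P₀ᵀ) * B * U := by
          simp only [Matrix.mul_assoc]
      _ = 1 := by rw [h2, Matrix.mul_one, hU])
  refine ⟨P₀ * O, ?_, ?_⟩
  · calc (P₀ * O)ᵀ * B * (P₀ * O) = Oᵀ * (P₀ᵀ * B * P₀) * O := by
          simp only [transpose_mul, Matrix.mul_assoc]
      _ = 1 := by rw [hP₀, Matrix.mul_one, hO]
  · have : O * frame d m = P₀ᵀ * B * U := by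
      ext i k
      rw [mul_frame_apply h, hOW]
    rw [Matrix.mul_assoc, this, ← Matrix.mul_assoc, h1, Matrix.one_mul]

/-- The rectangular diagonal matrix with diagonal entries `s 0, s 1, …`. -/
def rectDiagonal (a b : ℕ) (s : ℕ → ℝ) : Matrix (Fin a) (Fin b) ℝ :=
  of fun i j => if (i : ℕ) = j then s i else 0

lemma rectDiagonal_apply (a b : ℕ) (s : ℕ → ℝ) (i : Fin a) (j : Fin b) :
    rectDiagonal a b s i j = if (i : ℕ) = j then s i else 0 := rfl

/-- Optimal canonical weights extend to bases in which the cross-covariance is rectangular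
diagonal, and canonical correlations are nonnegative. -/
theorem exists_canonical_bases {dx dy m : ℕ} (hm : m = min dx dy)
    {Sxx : Matrix (Fin dx) (Fin dx) ℝ} {Syy : Matrix (Fin dy) (Fin dy) ℝ}
    {Sxy : Matrix (Fin dx) (Fin dy) ℝ} (hSxx : Sxx.PosDef) (hSyy : Syy.PosDef)
    {s : Fin m → ℝ} {U : Matrix (Fin dx) (Fin m) ℝ} {V : Matrix (Fin dy) (Fin m) ℝ}
    (hfeas : IsFeasible Sxx Syy Sxy s U V)
    (hmax : ∀ (s' : Fin m → ℝ) (U' : Matrix (Fin dx) (Fin m) ℝ)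
      (V' : Matrix (Fin dy) (Fin m) ℝ), IsFeasible Sxx Syy Sxy s' U' V' →
        trace (U'ᵀ * Sxy * V') ≤ trace (Uᵀ * Sxy * V)) :
    (∀ k, 0 ≤ s k) ∧ ∃ (P : Matrix (Fin dx) (Fin dx) ℝ) (Q : Matrix (Fin dy) (Fin dy) ℝ),
      Pᵀ * Sxx * P = 1 ∧ Qᵀ * Syy * Q = 1 ∧
      Pᵀ * Sxy * Q = rectDiagonal dx dy fun i => term s (i + 1) := by
  have hmx : m ≤ dx := by omega
  have hmy : m ≤ dy := by omega
  obtain ⟨P, hP, hUP⟩ := exists_basis_extension hmx hSxx hfeas.left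
  obtain ⟨Q, hQ, hVQ⟩ := exists_basis_extension hmy hSyy hfeas.right
  obtain ⟨A, hA⟩ : ∃ A, A = Pᵀ * Sxy * Q := ⟨_, rfl⟩
  have hconj : ∀ (o₁ : Matrix (Fin dx) (Fin m) ℝ) (o₂ : Matrix (Fin dy) (Fin m) ℝ),
      (P * o₁)ᵀ * Sxy * (Q * o₂) = o₁ᵀ * A * o₂ := by
    intro o₁ o₂
    simp only [hA, transpose_mul, Matrix.mul_assoc]
  have hUV : Uᵀ * Sxy * V = (frame dx m)ᵀ * A * frame dy m := by rw [hUP, hVQ, hconj]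
  obtain ⟨o₁, o₂, d, ho₁, ho₂, hdiag, hd, ho⟩ := exists_diagonal_trace_max hmx hmy A
  -- Optimality is assumed only against feasible triples, whose cross-covariance is diagonal and
  -- sorted. Some unconstrained maximizer has this form, so the given weights are optimal among all
  -- orthonormal frames.
  have hle : ∀ (q₁ : Matrix (Fin dx) (Fin m) ℝ) (q₂ : Matrix (Fin dy) (Fin m) ℝ),
      q₁ᵀ * q₁ = 1 → q₂ᵀ * q₂ = 1 →
        trace (q₁ᵀ * A * q₂) ≤ trace ((frame dx m)ᵀ * A * frame dy m) := by
    intro q₁ q₂ hq₁ hq₂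
    have h1 := hmax d (P * o₁) (Q * o₂) ⟨?_, ?_, by rw [hconj, hdiag], hd⟩
    · rw [hconj, hUV] at h1
      exact (ho q₁ q₂ hq₁ hq₂).trans h1
    · calc (P * o₁)ᵀ * Sxx * (P * o₁) = o₁ᵀ * (Pᵀ * Sxx * P) * o₁ := by
            simp only [transpose_mul, Matrix.mul_assoc]
        _ = 1 := by rw [hP, Matrix.mul_one, ho₁]
    · calc (Q * o₂)ᵀ * Syy * (Q * o₂) = o₂ᵀ * (Qᵀ * Syy * Q) * o₂ := by
            simp only [transpose_mul, Matrix.mul_assoc]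
        _ = 1 := by rw [hQ, Matrix.mul_one, ho₂]
  have hfx := frame_orthonormal hmx
  have hfy := frame_orthonormal hmy
  -- Orthogonal transformations of the whole space are used here, not just of the `m` chosen
  -- columns; the resulting symmetry forces the entries of `A` outside the leading block to vanish.
  have hG₂ := symm_of_trace_le (G := frame dy m * ((frame dx m)ᵀ * A)) fun R hR => by
    have := hle (frame dx m) (R * frame dy m) hfx (by
      rw [transpose_mul, Matrix.mul_assoc, ← Matrix.mul_assoc Rᵀ, hR, Matrix.one_mul, hfy])
    rwa [← Matrix.mul_assoc, trace_mul_comm (R * frame dy m), trace_mul_comm (frame dy m)]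
  have hG₁ := symm_of_trace_le (G := A * frame dy m * (frame dx m)ᵀ) fun R hR => by
    have hR' : R * Rᵀ = 1 := mul_eq_one_comm.1 hR
    have := hle (Rᵀ * frame dx m) (frame dy m) (by
      rw [transpose_mul, transpose_transpose, Matrix.mul_assoc, ← Matrix.mul_assoc R, hR',
        Matrix.one_mul, hfx]) hfy
    rw [transpose_mul, transpose_transpose] at this
    rw [← Matrix.mul_assoc, trace_mul_comm, trace_mul_comm (A * frame dy m)]
    simpa only [Matrix.mul_assoc] using this
  have hAfr : ∀ k l : Fin m, A (Fin.castLE hmx k) (Fin.castLE hmy l) = diagonal s k l := by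
    intro k l
    rw [← hfeas.diag, hUV, mul_frame_apply hmy, frame_transpose_mul_apply hmx]
  have hG₂app : ∀ (k : Fin m) (j : Fin dy),
      (frame dy m * ((frame dx m)ᵀ * A)) (Fin.castLE hmy k) j = A (Fin.castLE hmx k) j := by
    intro k j
    rw [mul_apply, Finset.sum_eq_single k]
    · simp [frame_apply, frame_transpose_mul_apply hmx]
    · intro l _ hl
      have : (k : ℕ) ≠ l := fun he => hl (Fin.ext he.symm)
      simp [frame_apply, this]
    · simp
  have hG₂zero : ∀ (j l : Fin dy), m ≤ j → (frame dy m * ((frame dx m)ᵀ * A)) j l = 0 := by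
    intro j l hj
    rw [mul_apply]
    refine Finset.sum_eq_zero fun k _ => ?_
    have : (j : ℕ) ≠ k := by omega
    simp [frame_apply, this]
  have hG₁app : ∀ (i : Fin dx) (k : Fin m),
      (A * frame dy m * (frame dx m)ᵀ) i (Fin.castLE hmx k) = A i (Fin.castLE hmy k) := by
    intro i k
    rw [mul_apply, Finset.sum_eq_single k]
    · simp [frame_apply, mul_frame_apply hmy]
    · intro l _ hl
      have : (k : ℕ) ≠ l := fun he => hl (Fin.ext he.symm)
      simp [frame_apply, this]
    · simp
  have hG₁zero : ∀ (i l : Fin dx), m ≤ l → (A * frame dy m * (frame dx m)ᵀ) i l = 0 := by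
    intro i l hl
    rw [mul_apply]
    refine Finset.sum_eq_zero fun k _ => ?_
    have : (l : ℕ) ≠ k := by omega
    simp [frame_apply, this]
  refine ⟨fun k => ?_, P, Q, hP, hQ, ?_⟩
  · have := hG₂.2 (Fin.castLE hmy k)
    rw [hG₂app, hAfr] at this
    simpa using this
  · rw [← hA]
    ext i j
    rw [rectDiagonal_apply]
    rcases lt_or_ge (i : ℕ) m with hi | hi
    · rcases lt_or_ge (j : ℕ) m with hj | hj
      · have := hAfr ⟨i, hi⟩ ⟨j, hj⟩
        simp only [Fin.castLE_mk, Fin.eta] at this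
        rw [this, diagonal_apply]
        by_cases hij : (i : ℕ) = j
        · simp [hij, term, hj]
        · simp [hij]
      · have hij : (i : ℕ) ≠ j := by omega
        have := hG₂app ⟨i, hi⟩ j
        simp only [Fin.castLE_mk, Fin.eta] at this
        rw [← this, hG₂.1, hG₂zero j _ hj, if_neg hij]
    -- Since `m` is the smaller dimension, no entry has both indices at least `m`.
    · have hj : (j : ℕ) < m := by omega
      have hij : (i : ℕ) ≠ j := by omega
      have := hG₁app i ⟨j, hj⟩
      simp only [Fin.castLE_mk, Fin.eta] at this
      rw [← this, hG₁.1, hG₁zero _ i hi, if_neg hij]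

end Bases


/-! ### Minimizers of the cost function -/

/-- Positive weights `μ 0 > … > μ (p - 1)` followed by `μ p = 0`, and nonnegative values
`s 0 > … > s p` followed by values that are at most `s p`. -/
structure IsGapped (p : ℕ) (μ s : ℕ → ℝ) : Prop where
  mu_lt : ∀ j < p, μ (j + 1) < μ j
  mu_last : μ p = 0
  s_lt : ∀ j < p, s (j + 1) < s j
  s_nonneg : ∀ i, 0 ≤ s i
  s_le : ∀ i, p ≤ i → s i ≤ s p

namespace IsGapped

variable {p : ℕ} {μ s : ℕ → ℝ}

lemma mu_anti (h : IsGapped p μ s) {i j : ℕ} (hij : i ≤ j) (hj : j ≤ p) : μ j ≤ μ i := by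
  induction j, hij using Nat.le_induction with
  | base => exact le_rfl
  | succ j hij ih => exact (h.mu_lt j (by omega)).le.trans (ih (by omega))

lemma mu_strictAnti (h : IsGapped p μ s) {i j : ℕ} (hij : i < j) (hj : j ≤ p) : μ j < μ i :=
  (h.mu_anti (Nat.succ_le_of_lt hij) hj).trans_lt (h.mu_lt i (by omega))

lemma mu_pos (h : IsGapped p μ s) {i : ℕ} (hi : i < p) : 0 < μ i :=
  h.mu_last ▸ h.mu_strictAnti hi le_rfl

lemma s_anti (h : IsGapped p μ s) {i j : ℕ} (hij : i ≤ j) (hi : i ≤ p) : s j ≤ s i := by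
  have key : ∀ j, i ≤ j → j ≤ p → s j ≤ s i := by
    intro j hij
    induction j, hij using Nat.le_induction with
    | base => exact fun _ => le_rfl
    | succ j hij ih => exact fun hj => (h.s_lt j (by omega)).le.trans (ih (by omega))
  rcases le_total j p with hj | hj
  · exact key j hij hj
  · exact (h.s_le j hj).trans (key p hi le_rfl)

lemma s_strictAnti (h : IsGapped p μ s) {i j : ℕ} (hij : i < j) (hi : i < p) : s j < s i :=
  (h.s_anti (Nat.succ_le_of_lt hij) hi).trans_lt (h.s_lt i hi)

lemma s_pos (h : IsGapped p μ s) {i : ℕ} (hi : i < p) : 0 < s i :=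
  (h.s_nonneg (i + 1)).trans_lt (h.s_lt i hi)

/-- The dual variables of the rows in the linear program behind the trace inequality. -/
noncomputable def dual (p : ℕ) (μ s : ℕ → ℝ) (i : ℕ) : ℝ :=
  ∑ j ∈ Finset.Ico i p, (μ j + μ (j + 1)) / 2 * (s j - s (j + 1))

lemma dual_eq_add {i : ℕ} (hi : i < p) :
    dual p μ s i = (μ i + μ (i + 1)) / 2 * (s i - s (i + 1)) + dual p μ s (i + 1) :=
  Finset.sum_eq_sum_Ico_succ_bot hi _

lemma dual_of_le {i : ℕ} (hi : p ≤ i) : dual p μ s i = 0 := by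
  simp [dual, Finset.Ico_eq_empty_of_le hi]

lemma dual_nonneg (h : IsGapped p μ s) (i : ℕ) : 0 ≤ dual p μ s i := by
  refine Finset.sum_nonneg fun j hj => ?_
  have hj' := (Finset.mem_Ico.1 hj).2
  have h1 := h.mu_pos hj'
  have h2 : 0 ≤ μ (j + 1) := h.mu_last ▸ h.mu_anti hj' le_rfl
  have h3 := h.s_lt j hj'
  exact mul_nonneg (by linarith) (by linarith)

/-- Each difference `s j - s (j + 1)` with `i ≤ j < k` is weighted by the mean of `μ j` and `μ (j +
1)`, which exceeds `μ k`. Taking the mean, rather than either endpoint, keeps this inequality and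
the next one both strict. -/
lemma dual_lt_of_lt (h : IsGapped p μ s) {i k : ℕ} (hik : i < k) (hk : k ≤ p) :
    μ k * (s i - s k) < dual p μ s i - dual p μ s k := by
  induction k, hik using Nat.le_induction with
  | base =>
    have h1 := h.mu_lt i hk
    have h2 := h.s_lt i hk
    rw [dual_eq_add hk]
    nlinarith
  | succ k hik ih =>
    have hik' : i < k := hik
    have h0 := ih (by omega)
    have h1 := h.mu_lt k hk
    have h2 := h.s_lt k hk
    have h3 := h.s_strictAnti hik' (by omega)
    rw [dual_eq_add (i := k) hk] at h0
    nlinarith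

/-- For `k ≤ j < i` the mean weight is below `μ k`. -/
lemma dual_lt_of_gt (h : IsGapped p μ s) {i k : ℕ} (hki : k < i) (hi : i ≤ p) :
    dual p μ s k - dual p μ s i < μ k * (s k - s i) := by
  induction i, hki using Nat.le_induction with
  | base =>
    have h1 := h.mu_lt k hi
    have h2 := h.s_lt k hi
    rw [dual_eq_add hi]
    nlinarith
  | succ i hki ih =>
    have hki' : k < i := hki
    have h0 := ih (by omega)
    have h1 := h.mu_lt i hi
    have h2 := h.s_lt i hi
    have h3 := h.mu_anti hki'.le (by omega)
    rw [dual_eq_add (i := i) hi] at h0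
    nlinarith

/-- Dual feasibility with row variables `dual i` and column variables `μ k * s k - dual k`. Strict
slack off the diagonal is what determines the maximizer. -/
lemma dual_lt (h : IsGapped p μ s) {i k : ℕ} (hk : k < p) (hik : i ≠ k) :
    0 < dual p μ s i + (μ k * s k - dual p μ s k) - μ k * s i := by
  rcases lt_or_gt_of_ne hik with hlt | hgt
  · have := h.dual_lt_of_lt hlt hk.le
    linarith
  · rcases le_total i p with hi | hi
    · have := h.dual_lt_of_gt hgt hi
      linarith
    -- Rows beyond `p` have zero dual variable and values at most `s p`, so the case `i = p`
    -- suffices.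
    · have h1 := h.dual_lt_of_gt hk le_rfl
      have h2 := mul_le_mul_of_nonneg_left (h.s_le i hi) (h.mu_pos hk).le
      rw [dual_of_le hi]
      rw [dual_of_le le_rfl] at h1
      linarith

end IsGapped

/-! ### The weighted trace inequality and its equality case -/

lemma sum_castLE_eq {d p : ℕ} (hpd : p ≤ d) {f : ℕ → ℝ} (hf : ∀ i, p ≤ i → f i = 0) :
    ∑ i : Fin d, f i = ∑ k : Fin p, f k := by
  rw [Fin.sum_univ_eq_sum_range, Fin.sum_univ_eq_sum_range]
  refine (Finset.sum_subset (Finset.range_mono hpd) fun i _ hi => hf i ?_).symm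
  simpa using hi

/-- `o * oᵀ` is a symmetric idempotent, so a diagonal entry `t` is the sum of the squares of its
row; hence `t² ≤ t` and `t ≤ 1`. -/
lemma sum_sq_row_le_one {d p : ℕ} {o : Matrix (Fin d) (Fin p) ℝ} (ho : oᵀ * o = 1) (i : Fin d) :
    ∑ k, o i k ^ 2 ≤ 1 := by
  have hidem : (o * oᵀ) * (o * oᵀ) = o * oᵀ := by
    rw [Matrix.mul_assoc, ← Matrix.mul_assoc oᵀ, ho, Matrix.one_mul]
  have h1 := congrFun (congrFun hidem i) i
  have h2 : (o * oᵀ) i i = ∑ k, o i k ^ 2 := by simp [mul_apply, sq]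
  have h3 : ((o * oᵀ) * (o * oᵀ)) i i = ∑ j, (o * oᵀ) i j ^ 2 := by
    rw [mul_apply]
    refine Finset.sum_congr rfl fun j _ => ?_
    have : (o * oᵀ) j i = (o * oᵀ) i j := by
      simp only [mul_apply, transpose_apply]
      exact Finset.sum_congr rfl fun k _ => mul_comm _ _
    rw [this, sq]
  have h4 : (o * oᵀ) i i ^ 2 ≤ ∑ j, (o * oᵀ) i j ^ 2 :=
    Finset.single_le_sum (f := fun j => (o * oᵀ) i j ^ 2) (fun j _ => sq_nonneg _)
      (Finset.mem_univ i)
  rw [← h2]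
  rw [← h3, h1] at h4
  nlinarith [sq_nonneg ((o * oᵀ) i i - 1)]

lemma sum_sq_col_eq_one {d p : ℕ} {o : Matrix (Fin d) (Fin p) ℝ} (ho : oᵀ * o = 1) (k : Fin p) :
    ∑ i, o i k ^ 2 = 1 := by
  have := congrFun (congrFun ho k) k
  simpa [mul_apply, sq] using this

/-- The weighted trace inequality for matrices with orthonormal columns, with its equality case. -/
lemma weighted_sum_sq_le {d p : ℕ} (hpd : p ≤ d) {μ s : ℕ → ℝ} (h : IsGapped p μ s)
    {o : Matrix (Fin d) (Fin p) ℝ} (ho : oᵀ * o = 1) :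
    ∑ k : Fin p, ∑ i : Fin d, μ k * s i * o i k ^ 2 ≤ ∑ k : Fin p, μ k * s k ∧
      (∑ k : Fin p, μ k * s k ≤ ∑ k : Fin p, ∑ i : Fin d, μ k * s i * o i k ^ 2 →
        ∀ (i : Fin d) (k : Fin p), (i : ℕ) ≠ k → o i k = 0) := by
  set α := IsGapped.dual p μ s with hα
  have hterm : ∀ (k : Fin p) (i : Fin d),
      0 ≤ (α i + (μ k * s k - α k) - μ k * s i) * o i k ^ 2 := by
    intro k i
    by_cases hik : (i : ℕ) = k
    · simp [hik]
    · exact mul_nonneg (h.dual_lt k.2 hik).le (sq_nonneg _)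
  -- Weak duality for the variables `o i k ^ 2`, with column sums 1 and row sums at most 1; the dual
  -- objective telescopes to `∑ μ k * s k`.
  have hsum : ∑ k : Fin p, ∑ i : Fin d, (α i + (μ k * s k - α k) - μ k * s i) * o i k ^ 2 +
      ∑ k : Fin p, ∑ i : Fin d, μ k * s i * o i k ^ 2 ≤ ∑ k : Fin p, μ k * s k := by
    have e1 : ∑ k : Fin p, ∑ i : Fin d, (α i + (μ k * s k - α k) - μ k * s i) * o i k ^ 2 +
        ∑ k : Fin p, ∑ i : Fin d, μ k * s i * o i k ^ 2 =
        ∑ i : Fin d, α i * ∑ k, o i k ^ 2 + ∑ k : Fin p, (μ k * s k - α k) * ∑ i, o i k ^ 2 := by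
      simp only [Finset.mul_sum]
      rw [Finset.sum_comm (f := fun (i : Fin d) (k : Fin p) => α i * o i k ^ 2),
        ← Finset.sum_add_distrib, ← Finset.sum_add_distrib]
      refine Finset.sum_congr rfl fun k _ => ?_
      rw [← Finset.sum_add_distrib, ← Finset.sum_add_distrib]
      exact Finset.sum_congr rfl fun i _ => by ring
    have e2 : ∑ i : Fin d, α i * ∑ k, o i k ^ 2 ≤ ∑ i : Fin d, α i :=
      Finset.sum_le_sum fun i _ =>
        mul_le_of_le_one_right (h.dual_nonneg i) (sum_sq_row_le_one ho i)
    rw [e1]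
    rw [sum_castLE_eq hpd (f := α) fun i hi => IsGapped.dual_of_le hi] at e2
    simp only [sum_sq_col_eq_one ho, mul_one, Finset.sum_sub_distrib]
    linarith
  have hnonneg : 0 ≤ ∑ k : Fin p, ∑ i : Fin d,
      (α i + (μ k * s k - α k) - μ k * s i) * o i k ^ 2 :=
    Finset.sum_nonneg fun k _ => Finset.sum_nonneg fun i _ => hterm k i
  refine ⟨by linarith, fun hge i k hik => ?_⟩
  -- Complementary slackness: at equality every slack term vanishes, and off the diagonal the slack
  -- factor is positive.
  have h0 : ∑ k : Fin p, ∑ i : Fin d,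
      (α i + (μ k * s k - α k) - μ k * s i) * o i k ^ 2 = 0 := by linarith
  rw [Finset.sum_eq_zero_iff_of_nonneg fun k _ => Finset.sum_nonneg fun i _ => hterm k i] at h0
  have h1 := h0 k (Finset.mem_univ k)
  rw [Finset.sum_eq_zero_iff_of_nonneg fun i _ => hterm k i] at h1
  have h2 := h1 i (Finset.mem_univ i)
  have h3 := h.dual_lt k.2 hik
  rw [← hα] at h3
  simpa [h3.ne'] using h2

lemma rectDiagonal_mul_frame {a b p : ℕ} (hb : p ≤ b) (s : ℕ → ℝ) (i : Fin a) (k : Fin p) :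
    (rectDiagonal a b s * frame b p) i k = if (i : ℕ) = k then s k else 0 := by
  rw [mul_frame_apply hb, rectDiagonal_apply]
  split_ifs with h1 h2 h2
  · rw [h1]; rfl
  · exact absurd h1 h2
  · exact absurd h2 h1
  · rfl

lemma trace_frame_rectDiagonal {a b p : ℕ} (ha : p ≤ a) (hb : p ≤ b) (μ s : ℕ → ℝ) :
    trace ((frame a p)ᵀ * rectDiagonal a b s * frame b p * diagonal fun k : Fin p => μ k) =
      ∑ k : Fin p, μ k * s k := by
  refine Finset.sum_congr rfl fun k _ => ?_
  rw [diag_apply, mul_diagonal, Matrix.mul_assoc, frame_transpose_mul_apply ha,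
    rectDiagonal_mul_frame hb]
  simp [mul_comm]

lemma trace_rectDiagonal {a b p : ℕ} (μ s : ℕ → ℝ) (u : Matrix (Fin a) (Fin p) ℝ)
    (v : Matrix (Fin b) (Fin p) ℝ) :
    trace (uᵀ * rectDiagonal a b s * v * diagonal fun k : Fin p => μ k) =
      ∑ k : Fin p, ∑ i : Fin a, ∑ j : Fin b,
        μ k * rectDiagonal a b s i j * (u i k * v j k) := by
  refine Finset.sum_congr rfl fun k _ => ?_
  rw [diag_apply, mul_diagonal, Matrix.mul_assoc, mul_apply, Finset.sum_mul]
  refine Finset.sum_congr rfl fun i _ => ?_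
  rw [mul_apply, Finset.mul_sum, Finset.sum_mul]
  refine Finset.sum_congr rfl fun j _ => ?_
  rw [transpose_apply]
  ring

lemma sum_rectDiagonal_row_le {a b : ℕ} {s : ℕ → ℝ} (hs : ∀ i, 0 ≤ s i) (i : Fin a) :
    ∑ j : Fin b, rectDiagonal a b s i j ≤ s i := by
  by_cases hi : (i : ℕ) < b
  · rw [Finset.sum_eq_single ⟨i, hi⟩]
    · simp [rectDiagonal_apply]
    · intro j _ hj
      have : (i : ℕ) ≠ j := fun he => hj (Fin.ext he.symm)
      simp [rectDiagonal_apply, this]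
    · simp
  · rw [Finset.sum_eq_zero]
    · exact hs i
    · intro j _
      have : (i : ℕ) ≠ j := by omega
      simp [rectDiagonal_apply, this]

lemma rectDiagonal_symm {a b : ℕ} (s : ℕ → ℝ) (i : Fin a) (j : Fin b) :
    rectDiagonal a b s i j = rectDiagonal b a s j i := by
  simp only [rectDiagonal_apply]
  split_ifs with h1 h2 h2
  · rw [h1]
  · exact absurd h1.symm h2
  · exact absurd h2.symm h1
  · rfl

lemma rectDiagonal_nonneg {a b : ℕ} {s : ℕ → ℝ} (hs : ∀ i, 0 ≤ s i) (i : Fin a) (j : Fin b) :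
    0 ≤ rectDiagonal a b s i j := by
  rw [rectDiagonal_apply]
  split_ifs
  exacts [hs _, le_rfl]

/-- Maximizers of `tr (uᵀ S v N)` for a rectangular diagonal matrix `S`: up to signs, `u` and `v`
consist of the first standard basis vectors. -/
lemma eq_frame_of_trace_ge {a b p : ℕ} (ha : p ≤ a) (hb : p ≤ b) {μ s : ℕ → ℝ}
    (h : IsGapped p μ s) {u : Matrix (Fin a) (Fin p) ℝ} {v : Matrix (Fin b) (Fin p) ℝ}
    (hu : uᵀ * u = 1) (hv : vᵀ * v = 1)
    (hge : ∑ k : Fin p, μ k * s k ≤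
      trace (uᵀ * rectDiagonal a b s * v * diagonal fun k : Fin p => μ k)) :
    ∃ ε : ℕ → ℝ, (∀ k, ε k * ε k = 1) ∧ (u = diagonal (fun i : Fin a => ε i) * frame a p) ∧
      (v = diagonal (fun i : Fin b => ε i) * frame b p) := by
  -- The inequality `2 u v ≤ u² + v²` separates the bilinear problem into one problem for `u` and
  -- one for `v`.
  have hle : trace (uᵀ * rectDiagonal a b s * v * diagonal fun k : Fin p => μ k) ≤
      1 / 2 * (∑ k : Fin p, ∑ i : Fin a, μ k * s i * u i k ^ 2) +
        1 / 2 * ∑ k : Fin p, ∑ j : Fin b, μ k * s j * v j k ^ 2 := by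
    rw [trace_rectDiagonal, Finset.mul_sum, Finset.mul_sum, ← Finset.sum_add_distrib]
    refine Finset.sum_le_sum fun k _ => ?_
    have hμ := (h.mu_pos k.2).le
    calc ∑ i : Fin a, ∑ j : Fin b, μ k * rectDiagonal a b s i j * (u i k * v j k)
        ≤ ∑ i : Fin a, ∑ j : Fin b, (1 / 2 * μ k * u i k ^ 2 * rectDiagonal a b s i j +
            1 / 2 * μ k * v j k ^ 2 * rectDiagonal b a s j i) := by
          refine Finset.sum_le_sum fun i _ => Finset.sum_le_sum fun j _ => ?_
          rw [rectDiagonal_symm s j i]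
          have := mul_nonneg (mul_nonneg hμ (rectDiagonal_nonneg h.s_nonneg i j))
            (sq_nonneg (u i k - v j k))
          linarith
      _ = ∑ i : Fin a, 1 / 2 * μ k * u i k ^ 2 * ∑ j : Fin b, rectDiagonal a b s i j +
            ∑ j : Fin b, 1 / 2 * μ k * v j k ^ 2 * ∑ i : Fin a, rectDiagonal b a s j i := by
          simp only [Finset.sum_add_distrib, Finset.mul_sum]
          congr 1
          exact Finset.sum_comm
      _ ≤ ∑ i : Fin a, 1 / 2 * μ k * u i k ^ 2 * s i +
            ∑ j : Fin b, 1 / 2 * μ k * v j k ^ 2 * s j := by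
          refine add_le_add (Finset.sum_le_sum fun i _ => ?_) (Finset.sum_le_sum fun j _ => ?_)
          · exact mul_le_mul_of_nonneg_left (sum_rectDiagonal_row_le h.s_nonneg i)
              (by positivity)
          · exact mul_le_mul_of_nonneg_left (sum_rectDiagonal_row_le h.s_nonneg j)
              (by positivity)
      _ = _ := by
          simp only [Finset.mul_sum]
          congr 1 <;> exact Finset.sum_congr rfl fun i _ => by ring
  obtain ⟨hu1, hu2⟩ := weighted_sum_sq_le ha h hu
  obtain ⟨hv1, hv2⟩ := weighted_sum_sq_le hb h hv
  have hu0 := hu2 (by linarith)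
  have hv0 := hv2 (by linarith)
  have hdiag : ∀ {c : ℕ} (hc : p ≤ c) {o : Matrix (Fin c) (Fin p) ℝ}, oᵀ * o = 1 →
      (∀ (i : Fin c) (k : Fin p), (i : ℕ) ≠ k → o i k = 0) → ∀ k, o (Fin.castLE hc k) k ^ 2 = 1 := by
    intro c hc o ho h0 k
    rw [← sum_sq_col_eq_one ho k, Finset.sum_eq_single (Fin.castLE hc k)]
    · intro i _ hi
      rw [h0 i k fun he => hi (Fin.ext he)]
      simp
    · simp
  have hu3 := hdiag ha hu hu0
  have hv3 := hdiag hb hv hv0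
  have hform : trace (uᵀ * rectDiagonal a b s * v * diagonal fun k : Fin p => μ k) =
      ∑ k : Fin p, μ k * s k * (u (Fin.castLE ha k) k * v (Fin.castLE hb k) k) := by
    rw [trace_rectDiagonal]
    refine Finset.sum_congr rfl fun k _ => ?_
    rw [Finset.sum_eq_single (Fin.castLE ha k), Finset.sum_eq_single (Fin.castLE hb k)]
    · simp [rectDiagonal_apply]
    · intro j _ hj
      rw [hv0 j k fun he => hj (Fin.ext he)]
      simp
    · simp
    · intro i _ hi
      simp [hu0 i k fun he => hi (Fin.ext he)]
    · simp
  -- The surviving entries are ±1, and the positive weights `μ k * s k` force equal signs in `u` and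
  -- `v`.
  have hprod : ∀ k, u (Fin.castLE ha k) k * v (Fin.castLE hb k) k = 1 := by
    have hnn : ∀ k ∈ Finset.univ, 0 ≤ μ (k : Fin p) * s k *
        (1 - u (Fin.castLE ha k) k * v (Fin.castLE hb k) k) := by
      intro k _
      refine mul_nonneg (mul_pos (h.mu_pos k.2) (h.s_pos k.2)).le ?_
      nlinarith [sq_nonneg (u (Fin.castLE ha k) k - v (Fin.castLE hb k) k), hu3 k, hv3 k]
    have h0 : ∑ k : Fin p, μ k * s k *
        (1 - u (Fin.castLE ha k) k * v (Fin.castLE hb k) k) = 0 := by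
      refine le_antisymm ?_ (Finset.sum_nonneg hnn)
      rw [hform] at hge
      simp only [mul_sub, mul_one, Finset.sum_sub_distrib]
      linarith
    intro k
    have h1 := (Finset.sum_eq_zero_iff_of_nonneg hnn).1 h0 k (Finset.mem_univ k)
    have h2 := mul_pos (h.mu_pos k.2) (h.s_pos k.2)
    rcases mul_eq_zero.1 h1 with h3 | h3
    · exact absurd h3 h2.ne'
    · linarith
  have heq : ∀ k, u (Fin.castLE ha k) k = v (Fin.castLE hb k) k := by
    intro k
    have := hprod k
    have h1 : (u (Fin.castLE ha k) k - v (Fin.castLE hb k) k) ^ 2 = 0 := by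
      linear_combination hu3 k + hv3 k - 2 * this
    exact sub_eq_zero.1 (pow_eq_zero_iff two_ne_zero |>.1 h1)
  -- Beyond `p` the sign is set to 1, so that the same sequence gives an orthogonal diagonal matrix
  -- of any size.
  refine ⟨fun k => if hk : k < p then u (Fin.castLE ha ⟨k, hk⟩) ⟨k, hk⟩ else 1, ?_, ?_, ?_⟩
  · intro k
    by_cases hk : k < p
    · simpa [hk, sq] using hu3 ⟨k, hk⟩
    · simp [hk]
  · ext i k
    rw [diagonal_mul, frame_apply]
    by_cases hik : (i : ℕ) = k
    · simp [show i = Fin.castLE ha k from Fin.ext hik]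
    · simp [hik, hu0 i k hik]
  · ext i k
    rw [diagonal_mul, frame_apply]
    by_cases hik : (i : ℕ) = k
    · simp [show i = Fin.castLE hb k from Fin.ext hik, heq k]
    · simp [hik, hv0 i k hik]


/-! ### The Hessian form in coordinates -/

section Coordinates

variable {p : ℕ}

/-- The quadratic form of the Hessian in coordinates with respect to the canonical bases. -/
def coordForm (D : ℕ) (μ s : ℕ → ℝ) (α β : ℕ → Fin p → ℝ) : ℝ :=
  ∑ k : Fin p, ∑ i ∈ Finset.range D,
    μ k * (s k * (α i k ^ 2 + β i k ^ 2) - 2 * s i * (α i k * β i k))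

/-- The squared norm in coordinates with respect to the canonical bases. -/
def coordNormSq (D : ℕ) (α β : ℕ → Fin p → ℝ) : ℝ :=
  ∑ k : Fin p, ∑ i ∈ Finset.range D, (α i k ^ 2 + β i k ^ 2)

lemma sum_le_sum_of_symm {f g : Fin p → Fin p → ℝ}
    (h : ∀ k i, f k i + f i k ≤ g k i + g i k) :
    ∑ k, ∑ i, f k i ≤ ∑ k, ∑ i, g k i := by
  have key : ∀ f : Fin p → Fin p → ℝ,
      ∑ k, ∑ i, (f k i + f i k) = 2 * ∑ k, ∑ i, f k i := by
    intro f
    simp only [Finset.sum_add_distrib]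
    rw [Finset.sum_comm (f := fun k i => f i k)]
    ring
  have h1 : ∑ k, ∑ i, (f k i + f i k) ≤ ∑ k, ∑ i, (g k i + g i k) :=
    Finset.sum_le_sum fun k _ => Finset.sum_le_sum fun i _ => h k i
  rw [key, key] at h1
  linarith

/-- Rows from `p` on are compared termwise. In the leading square the entries at `(i, k)` and `(k,
i)` are coupled by skewness and can only be compared together. -/
lemma sum_range_le_sum_range {D : ℕ} (hD : p ≤ D) {f g : ℕ → Fin p → ℝ}
    (hrow : ∀ i k, p ≤ i → f i k ≤ g i k)
    (hpair : ∀ i k : Fin p, f i k + f k i ≤ g i k + g k i) :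
    ∑ k : Fin p, ∑ i ∈ Finset.range D, f i k ≤ ∑ k : Fin p, ∑ i ∈ Finset.range D, g i k := by
  have key : ∀ f : ℕ → Fin p → ℝ, ∑ k : Fin p, ∑ i ∈ Finset.range D, f i k =
      ∑ k : Fin p, ∑ i : Fin p, f i k + ∑ k : Fin p, ∑ i ∈ Finset.Ico p D, f i k := by
    intro f
    rw [← Finset.sum_add_distrib]
    refine Finset.sum_congr rfl fun k _ => ?_
    rw [Fin.sum_univ_eq_sum_range (fun i => f i k) p, Finset.sum_range_add_sum_Ico _ hD]
  rw [key, key]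
  refine add_le_add (sum_le_sum_of_symm fun k i => ?_) ?_
  · linarith [hpair i k]
  · exact Finset.sum_le_sum fun k _ => Finset.sum_le_sum fun i hi =>
      hrow i k (Finset.mem_Ico.1 hi).1

variable {D : ℕ} {μ s : ℕ → ℝ} {α β : ℕ → Fin p → ℝ}

/-- Removing a nonnegative multiple of `(α - β)²` from each block leaves its smaller eigenvalue
times `α² + β²`. For a skew pair the squared norm counts twice, whence the factor 2 in `hpair`. -/
lemma le_coordForm (hD : p ≤ D) (h : IsGapped p μ s) {lo : ℝ}
    (hα : ∀ k l : Fin p, α k l + α l k = 0) (hβ : ∀ k l : Fin p, β k l + β l k = 0)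
    (hrow : ∀ k < p, ∀ i, p ≤ i → lo ≤ μ k * (s k - s i))
    (hpair : ∀ k < p, ∀ i < k, 2 * lo ≤ (μ i - μ k) * (s i - s k)) :
    lo * coordNormSq D α β ≤ coordForm D μ s α β := by
  unfold coordForm coordNormSq
  simp only [Finset.mul_sum]
  refine sum_range_le_sum_range hD (fun i k hi => ?_) fun i k => ?_
  · have h1 := mul_le_mul_of_nonneg_right (hrow k k.2 i hi)
      (add_nonneg (sq_nonneg (α i k)) (sq_nonneg (β i k)))
    have h2 := mul_nonneg (mul_nonneg (h.mu_pos k.2).le (h.s_nonneg i))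
      (sq_nonneg (α i k - β i k))
    linarith
  · have e1 : α k i = -α i k := by linarith [hα i k]
    have e2 : β k i = -β i k := by linarith [hβ i k]
    rcases eq_or_ne i k with rfl | hik
    · have e3 : α i i = 0 := by linarith
      have e4 : β i i = 0 := by linarith
      simp [e3, e4]
    · have hc : 2 * lo ≤ (μ i - μ k) * (s i - s k) := by
        rcases lt_or_gt_of_ne hik with hlt | hgt
        · exact hpair k k.2 i hlt
        · have := hpair i i.2 k hgt
          linarith
      have h1 := mul_le_mul_of_nonneg_right hc
        (add_nonneg (sq_nonneg (α i k)) (sq_nonneg (β i k)))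
      have h2 := mul_nonneg (add_nonneg
        (mul_nonneg (h.mu_pos k.2).le (h.s_nonneg i)) (mul_nonneg (h.mu_pos i.2).le (h.s_nonneg k)))
        (sq_nonneg (α i k - β i k))
      rw [e1, e2]
      linarith

/-- As for the lower bound, with `(α + β)²` completing each block to its larger eigenvalue. -/
lemma coordForm_le (hD : p ≤ D) (h : IsGapped p μ s) {hi : ℝ}
    (hα : ∀ k l : Fin p, α k l + α l k = 0) (hβ : ∀ k l : Fin p, β k l + β l k = 0)
    (hrow : ∀ k < p, ∀ i, p ≤ i → μ k * (s k + s i) ≤ hi)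
    (hpair : ∀ k < p, ∀ i < k, (μ i + μ k) * (s i + s k) ≤ 2 * hi) :
    coordForm D μ s α β ≤ hi * coordNormSq D α β := by
  unfold coordForm coordNormSq
  simp only [Finset.mul_sum]
  refine sum_range_le_sum_range hD (fun i k hi => ?_) fun i k => ?_
  · have h1 := mul_le_mul_of_nonneg_right (hrow k k.2 i hi)
      (add_nonneg (sq_nonneg (α i k)) (sq_nonneg (β i k)))
    have h2 := mul_nonneg (mul_nonneg (h.mu_pos k.2).le (h.s_nonneg i))
      (sq_nonneg (α i k + β i k))
    linarith
  · have e1 : α k i = -α i k := by linarith [hα i k]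
    have e2 : β k i = -β i k := by linarith [hβ i k]
    rcases eq_or_ne i k with rfl | hik
    · have e3 : α i i = 0 := by linarith
      have e4 : β i i = 0 := by linarith
      simp [e3, e4]
    · have hc : (μ i + μ k) * (s i + s k) ≤ 2 * hi := by
        rcases lt_or_gt_of_ne hik with hlt | hgt
        · exact hpair k k.2 i hlt
        · have := hpair i i.2 k hgt
          linarith
      have h1 := mul_le_mul_of_nonneg_right hc
        (add_nonneg (sq_nonneg (α i k)) (sq_nonneg (β i k)))
      have h2 := mul_nonneg (add_nonneg
        (mul_nonneg (h.mu_pos k.2).le (h.s_nonneg i)) (mul_nonneg (h.mu_pos i.2).le (h.s_nonneg k)))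
        (sq_nonneg (α i k + β i k))
      rw [e1, e2]
      linarith

/-- A sum over index pairs with at most two nonzero terms. -/
lemma sum_pair_support {f : ℕ → Fin p → ℝ} (hD : p ≤ D) {i k : Fin p} (hik : i ≠ k)
    (hf : ∀ (j : ℕ) (l : Fin p), ¬(j = i ∧ l = k) → ¬(j = k ∧ l = i) → f j l = 0) :
    ∑ l : Fin p, ∑ j ∈ Finset.range D, f j l = f i k + f k i := by
  rw [Fintype.sum_eq_add k i hik.symm]
  · congr 1
    · rw [Finset.sum_eq_single (i : ℕ)]
      · intro j _ hj
        exact hf j k (fun h => hj h.1) fun h => hik h.2.symm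
      · intro h
        exact absurd (Finset.mem_range.2 (i.2.trans_le hD)) h
    · rw [Finset.sum_eq_single (k : ℕ)]
      · intro j _ hj
        exact hf j i (fun h => hik h.2) fun h => hj h.1
      · intro h
        exact absurd (Finset.mem_range.2 (k.2.trans_le hD)) h
  · rintro l ⟨hlk, hli⟩
    exact Finset.sum_eq_zero fun j _ => hf j l (fun h => hlk h.2) fun h => hli h.2

/-- A sum over index pairs with at most one nonzero term. -/
lemma sum_single_support {f : ℕ → Fin p → ℝ} {i : ℕ} (hi : i < D) {k : Fin p}
    (hf : ∀ (j : ℕ) (l : Fin p), ¬(j = i ∧ l = k) → f j l = 0) :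
    ∑ l : Fin p, ∑ j ∈ Finset.range D, f j l = f i k := by
  rw [Finset.sum_eq_single k, Finset.sum_eq_single i]
  · exact fun j _ hj => hf j k fun h => hj h.1
  · exact fun h => absurd (Finset.mem_range.2 hi) h
  · exact fun l _ hl => Finset.sum_eq_zero fun j _ => hf j l fun h => hl h.2
  · simp

/-- Extension of a matrix by zero rows. -/
def zeroExt {d : ℕ} (a : Matrix (Fin d) (Fin p) ℝ) (i : ℕ) (k : Fin p) : ℝ :=
  if h : i < d then a ⟨i, h⟩ k else 0

lemma zeroExt_coe {d : ℕ} (a : Matrix (Fin d) (Fin p) ℝ) (i : Fin d) (k : Fin p) :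
    zeroExt a i k = a i k := by
  simp [zeroExt]

lemma zeroExt_of_ge {d : ℕ} (a : Matrix (Fin d) (Fin p) ℝ) {i : ℕ} (hi : d ≤ i) (k : Fin p) :
    zeroExt a i k = 0 := by
  simp [zeroExt, hi]

lemma sum_zeroExt {d : ℕ} (hd : d ≤ D) (a : Matrix (Fin d) (Fin p) ℝ) (k : Fin p)
    (F : ℕ → ℝ → ℝ) (hF : ∀ i, F i 0 = 0) :
    ∑ i : Fin d, F i (a i k) = ∑ i ∈ Finset.range D, F i (zeroExt a i k) := by
  rw [← Finset.sum_subset (Finset.range_mono hd), ← Fin.sum_univ_eq_sum_range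
    (fun i => F i (zeroExt a i k))]
  · simp only [zeroExt_coe]
  · intro i _ hi
    rw [zeroExt_of_ge a (by simpa using hi), hF]

lemma trace_self_mul_diagonal {d : ℕ} (hd : d ≤ D) (a : Matrix (Fin d) (Fin p) ℝ) (c : ℕ → ℝ) :
    trace (aᵀ * a * diagonal fun k : Fin p => c k) =
      ∑ k : Fin p, ∑ i ∈ Finset.range D, c k * zeroExt a i k ^ 2 := by
  refine Finset.sum_congr rfl fun k _ => ?_
  rw [diag_apply, mul_diagonal, mul_apply, Finset.sum_mul,
    ← sum_zeroExt hd a k (fun _ x => c k * x ^ 2) (by simp)]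
  refine Finset.sum_congr rfl fun i _ => ?_
  rw [transpose_apply]
  ring

lemma trace_rectDiagonal_zeroExt {d e : ℕ} (hd : d ≤ D) (μ s : ℕ → ℝ)
    (a : Matrix (Fin d) (Fin p) ℝ) (b : Matrix (Fin e) (Fin p) ℝ) :
    trace (aᵀ * rectDiagonal d e s * b * diagonal fun k : Fin p => μ k) =
      ∑ k : Fin p, ∑ i ∈ Finset.range D, μ k * s i * (zeroExt a i k * zeroExt b i k) := by
  rw [trace_rectDiagonal]
  refine Finset.sum_congr rfl fun k _ => ?_
  rw [← sum_zeroExt hd a k (fun i x => μ k * s i * (x * zeroExt b i k)) (by simp)]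
  refine Finset.sum_congr rfl fun i _ => ?_
  by_cases hi : (i : ℕ) < e
  · rw [Finset.sum_eq_single ⟨i, hi⟩]
    · simp [rectDiagonal_apply, zeroExt, hi]
    · intro j _ hj
      have : (i : ℕ) ≠ j := fun he => hj (Fin.ext he.symm)
      simp [rectDiagonal_apply, this]
    · simp
  · rw [Finset.sum_eq_zero, zeroExt_of_ge b (not_lt.1 hi)]
    · simp
    · intro j _
      have : (i : ℕ) ≠ j := by omega
      simp [rectDiagonal_apply, this]

lemma coordForm_zeroExt {d e : ℕ} (hd : d ≤ D) (he : e ≤ D) (μ s : ℕ → ℝ)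
    (a : Matrix (Fin d) (Fin p) ℝ) (b : Matrix (Fin e) (Fin p) ℝ) :
    trace (aᵀ * a * diagonal fun k : Fin p => μ k * s k) +
        trace (bᵀ * b * diagonal fun k : Fin p => μ k * s k) -
        2 * trace (aᵀ * rectDiagonal d e s * b * diagonal fun k : Fin p => μ k) =
      coordForm D μ s (zeroExt a) (zeroExt b) := by
  rw [trace_self_mul_diagonal hd a (fun k => μ k * s k),
    trace_self_mul_diagonal he b (fun k => μ k * s k), trace_rectDiagonal_zeroExt hd, coordForm]
  simp only [Finset.mul_sum, ← Finset.sum_add_distrib, ← Finset.sum_sub_distrib]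
  exact Finset.sum_congr rfl fun k _ => Finset.sum_congr rfl fun i _ => by ring

lemma coordNormSq_zeroExt {d e : ℕ} (hd : d ≤ D) (he : e ≤ D)
    (a : Matrix (Fin d) (Fin p) ℝ) (b : Matrix (Fin e) (Fin p) ℝ) :
    trace (aᵀ * a) + trace (bᵀ * b) = coordNormSq D (zeroExt a) (zeroExt b) := by
  have h1 := trace_self_mul_diagonal hd a fun _ => 1
  have h2 := trace_self_mul_diagonal he b fun _ => 1
  rw [diagonal_one, Matrix.mul_one] at h1 h2
  rw [h1, h2, coordNormSq]
  simp only [one_mul, Finset.sum_add_distrib]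

/-- Test coordinates supported in the row `p`. -/
def rowTest (p d : ℕ) (τ : ℝ) (k : Fin p) : Matrix (Fin d) (Fin p) ℝ :=
  of fun i l => if (i : ℕ) = p ∧ l = k then τ else 0

/-- Skew-symmetric test coordinates supported in the rows `i` and `k`. -/
def pairTest (d : ℕ) (τ : ℝ) (i k : Fin p) : Matrix (Fin d) (Fin p) ℝ :=
  of fun j l => if (j : ℕ) = i ∧ l = k then τ else if (j : ℕ) = k ∧ l = i then -τ else 0

lemma zeroExt_rowTest (d : ℕ) (τ : ℝ) (k : Fin p) (j : ℕ) (l : Fin p) :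
    zeroExt (rowTest p d τ k) j l = if j = p ∧ l = k then (if p < d then τ else 0) else 0 := by
  by_cases h : j = p
  · subst h
    by_cases hd : j < d <;> simp [zeroExt, rowTest, hd]
  · simp [zeroExt, rowTest, h]

lemma zeroExt_pairTest {d : ℕ} (hd : p ≤ d) (τ : ℝ) (i k : Fin p) (j : ℕ) (l : Fin p) :
    zeroExt (pairTest d τ i k) j l =
      if j = i ∧ l = k then τ else if j = k ∧ l = i then -τ else 0 := by
  by_cases h : j < d
  · simp [zeroExt, pairTest, h]
  · have h1 : j ≠ i := by omega
    have h2 : j ≠ k := by omega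
    simp [zeroExt, h, h1, h2]

/-- `τ = 1` and `τ = -1` give the two eigenvectors of the block at row `p`. If that row exists in
only one factor, the cross term is absent, and `s p = 0` makes the formula correct still. -/
lemma coordForm_rowTest {d e : ℕ} (hp : p < max d e) (hs : p < d → p < e ∨ s p = 0)
    (hs' : p < e → p < d ∨ s p = 0) (k : Fin p) {τ : ℝ} (hτ : τ ^ 2 = 1) :
    coordForm (max d e) μ s (zeroExt (rowTest p d 1 k)) (zeroExt (rowTest p e τ k)) =
        μ k * (s k - τ * s p) *
          coordNormSq (max d e) (zeroExt (rowTest p d 1 k)) (zeroExt (rowTest p e τ k)) ∧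
      0 < coordNormSq (max d e) (zeroExt (rowTest p d 1 k)) (zeroExt (rowTest p e τ k)) := by
  unfold coordForm coordNormSq
  rw [sum_single_support hp (k := k), sum_single_support hp (k := k)]
  · simp only [zeroExt_rowTest, and_self, if_true]
    by_cases h1 : p < d
    · by_cases h2 : p < e
      · simp only [h1, h2, if_true, hτ]
        refine ⟨?_, by norm_num⟩
        linear_combination (-(2 * μ k * s k) + 2 * μ k * s k) * hτ
      · have h3 := (hs h1).resolve_left h2
        simp [h1, h2, h3]
    · have h2 : p < e := by simpa [h1] using hp
      have h3 := (hs' h2).resolve_left h1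
      simp [h1, h2, h3, hτ]
  · intro j l h
    simp [zeroExt_rowTest, h]
  · intro j l h
    simp [zeroExt_rowTest, h]

/-- With `τ = 1` the coefficient factors as `½ (μ i - μ k)(s i - s k)`, with `τ = -1` as `½ (μ i + μ
k)(s i + s k)`. -/
lemma coordForm_pairTest {d e : ℕ} (hd : p ≤ d) (he : p ≤ e) {i k : Fin p} (hik : i ≠ k)
    {τ : ℝ} (hτ : τ ^ 2 = 1) :
    coordForm (max d e) μ s (zeroExt (pairTest d 1 i k)) (zeroExt (pairTest e τ i k)) =
        1 / 2 * (μ i * s i + μ k * s k - τ * (μ i * s k + μ k * s i)) *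
          coordNormSq (max d e) (zeroExt (pairTest d 1 i k)) (zeroExt (pairTest e τ i k)) ∧
      0 < coordNormSq (max d e) (zeroExt (pairTest d 1 i k)) (zeroExt (pairTest e τ i k)) := by
  have hD : p ≤ max d e := hd.trans (le_max_left d e)
  unfold coordForm coordNormSq
  rw [sum_pair_support hD hik, sum_pair_support hD hik]
  · have h1 : (k : ℕ) ≠ i := fun h => hik (Fin.ext h.symm)
    simp only [zeroExt_pairTest hd, zeroExt_pairTest he, and_self, if_true, h1, false_and, if_false,
      neg_sq, hτ]
    refine ⟨?_, by norm_num⟩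
    ring
  · intro j l h h'
    simp [zeroExt_pairTest hd, zeroExt_pairTest he, h, h']
  · intro j l h h'
    simp [zeroExt_pairTest hd, zeroExt_pairTest he, h, h']

end Coordinates


/-! ### The baseline condition number -/

section KappaStar

variable {p : ℕ} {μ s : ℕ → ℝ}

lemma kappaStarDen_le_last (p : ℕ) (μ s : ℕ → ℝ) :
    kappaStarDen p μ s ≤ μ p * (s p - s (p + 1)) :=
  (Finset.fold_min_le _).2 (Or.inl le_rfl)

lemma kappaStarDen_le_adjacent {j : ℕ} (h1 : 1 ≤ j) (h2 : j < p) :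
    kappaStarDen p μ s ≤ 1 / 2 * (μ j - μ (j + 1)) * (s j - s (j + 1)) :=
  (Finset.fold_min_le _).2 (Or.inr ⟨j, Finset.mem_Ico.2 ⟨h1, h2⟩, le_rfl⟩)

lemma kappaStarDen_attained (p : ℕ) (μ s : ℕ → ℝ) :
    μ p * (s p - s (p + 1)) ≤ kappaStarDen p μ s ∨
      ∃ j, 1 ≤ j ∧ j < p ∧
        1 / 2 * (μ j - μ (j + 1)) * (s j - s (j + 1)) ≤ kappaStarDen p μ s := by
  rcases (Finset.fold_min_le _).1 (le_refl (kappaStarDen p μ s)) with h | ⟨j, hj, h⟩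
  · exact Or.inl h
  · exact Or.inr ⟨j, (Finset.mem_Ico.1 hj).1, (Finset.mem_Ico.1 hj).2, h⟩

lemma kappaStarDen_pos (hp : 1 ≤ p)
    (h : IsGapped p (fun k => μ (k + 1)) fun i => s (i + 1)) : 0 < kappaStarDen p μ s := by
  obtain ⟨q, rfl⟩ : ∃ q, p = q + 1 := ⟨p - 1, by omega⟩
  rcases kappaStarDen_attained (q + 1) μ s with h1 | ⟨j, hj1, hj2, h1⟩
  · have h2 := h.mu_pos (i := q) (by omega)
    have h3 := h.s_lt q (by omega)
    exact (mul_pos h2 (sub_pos.2 h3)).trans_le h1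
  · obtain ⟨i, rfl⟩ : ∃ i, j = i + 1 := ⟨j - 1, by omega⟩
    have h2 := h.mu_lt i (by omega)
    have h3 := h.s_lt i (by omega)
    exact (mul_pos (mul_pos (by norm_num) (sub_pos.2 h2)) (sub_pos.2 h3)).trans_le h1

/-- Both factors are smallest at the last column and the first row beyond it. -/
lemma kappaStarDen_le_row (h : IsGapped p (fun k => μ (k + 1)) fun i => s (i + 1)) :
    ∀ k < p, ∀ i, p ≤ i → kappaStarDen p μ s ≤ μ (k + 1) * (s (k + 1) - s (i + 1)) := by
  intro k hk i hi
  obtain ⟨q, rfl⟩ : ∃ q, p = q + 1 := ⟨p - 1, by omega⟩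
  have h1 := h.mu_anti (i := k) (j := q) (by omega) (by omega)
  have h2 := h.s_anti (i := k) (j := q) (by omega) (by omega)
  have h3 := h.s_le i hi
  have h4 := h.mu_pos hk
  have h5 := h.s_lt q (by omega)
  exact (kappaStarDen_le_last _ μ s).trans
    (mul_le_mul h1 (by linarith) (by linarith) h4.le)

/-- Monotonicity bounds both gaps between `i` and `k` below by the adjacent gaps at `i`. -/
lemma kappaStarDen_le_pair (h : IsGapped p (fun k => μ (k + 1)) fun i => s (i + 1)) :
    ∀ k < p, ∀ i < k, 2 * kappaStarDen p μ s ≤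
      (μ (i + 1) - μ (k + 1)) * (s (i + 1) - s (k + 1)) := by
  intro k hk i hi
  have h1 := kappaStarDen_le_adjacent (μ := μ) (s := s) (j := i + 1) (p := p) (by omega) (by omega)
  have h2 := h.mu_anti (i := i + 1) (j := k) (by omega) (by omega)
  have h3 := h.s_anti (i := i + 1) (j := k) (by omega) (by omega)
  have h4 := h.mu_lt i (by omega)
  have h5 := h.s_lt i (by omega)
  have h6 : (μ (i + 1) - μ (i + 1 + 1)) * (s (i + 1) - s (i + 1 + 1)) ≤
      (μ (i + 1) - μ (k + 1)) * (s (i + 1) - s (k + 1)) :=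
    mul_le_mul (by linarith) (by linarith) (by linarith) (by linarith)
  linarith

lemma row_le_kappaStarNum (hp : 1 ≤ p)
    (h : IsGapped p (fun k => μ (k + 1)) fun i => s (i + 1)) :
    ∀ k < p, ∀ i, p ≤ i → μ (k + 1) * (s (k + 1) + s (i + 1)) ≤ kappaStarNum p μ s := by
  intro k hk i hi
  have h1 := h.mu_anti (i := 0) (j := k) (by omega) (by omega)
  have h2 := h.s_anti (i := 0) (j := k) (by omega) (by omega)
  have h3 := h.s_le i hi
  have h4 := h.mu_pos hp
  have h5 := h.s_nonneg k
  have h6 := h.s_nonneg i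
  have h7 : μ (k + 1) * (s (k + 1) + s (i + 1)) ≤ μ 1 * (s 1 + s (p + 1)) :=
    mul_le_mul h1 (add_le_add h2 h3) (add_nonneg h5 h6) h4.le
  unfold kappaStarNum
  split_ifs
  exacts [h7.trans (le_max_left _ _), h7]

/-- Both sums are largest for the first two indices. -/
lemma pair_le_kappaStarNum (h : IsGapped p (fun k => μ (k + 1)) fun i => s (i + 1)) :
    ∀ k < p, ∀ i < k, (μ (i + 1) + μ (k + 1)) * (s (i + 1) + s (k + 1)) ≤
      2 * kappaStarNum p μ s := by
  intro k hk i hi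
  have h1 := h.mu_anti (i := 0) (j := i) (by omega) (by omega)
  have h2 := h.s_anti (i := 0) (j := i) (by omega) (by omega)
  have h3 := h.mu_anti (i := 1) (j := k) (by omega) (by omega)
  have h4 := h.s_anti (i := 1) (j := k) (by omega) (by omega)
  have h5 := h.mu_pos (i := 0) (by omega)
  have h6 := h.mu_pos (i := 1) (by omega)
  have h7 := h.s_nonneg i
  have h8 := h.s_nonneg k
  have h9 : (μ (i + 1) + μ (k + 1)) * (s (i + 1) + s (k + 1)) ≤ (μ 1 + μ 2) * (s 1 + s 2) :=
    mul_le_mul (add_le_add h1 h3) (add_le_add h2 h4) (add_nonneg h7 h8) (add_pos h5 h6).le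
  have h10 : 1 / 2 * (μ 1 + μ 2) * (s 1 + s 2) ≤ kappaStarNum p μ s := by
    rw [kappaStarNum, if_pos (by omega)]
    exact le_max_right _ _
  linarith

lemma kappaStarNum_attained (p : ℕ) (μ s : ℕ → ℝ) :
    kappaStarNum p μ s ≤ μ 1 * (s 1 + s (p + 1)) ∨
      2 ≤ p ∧ kappaStarNum p μ s ≤ 1 / 2 * (μ 1 + μ 2) * (s 1 + s 2) := by
  unfold kappaStarNum
  split_ifs with hp
  · rcases max_choice (μ 1 * (s 1 + s (p + 1))) (1 / 2 * (μ 1 + μ 2) * (s 1 + s 2)) with h | h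
    · exact Or.inl h.le
    · exact Or.inr ⟨hp, h.le⟩
  · exact Or.inl le_rfl

end KappaStar

/-! ### Weighted trace forms and the cost function -/

section Forms

/-- The bilinear form `tr (ηᵀ A ξ N)`. -/
noncomputable def weightedForm {d c : Type*} [Fintype d] [Fintype c] (A : Matrix d d ℝ)
    (N : Matrix c c ℝ) : LinearMap.BilinForm ℝ (Matrix d c ℝ) :=
  LinearMap.mk₂ ℝ (fun ξ η => trace (ηᵀ * A * ξ * N))
    (by intros; simp [Matrix.mul_add, Matrix.add_mul])
    (by intros; simp)
    (by intros; simp [Matrix.add_mul])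
    (by intros; simp)

lemma weightedForm_apply {d c : Type*} [Fintype d] [Fintype c] (A : Matrix d d ℝ)
    (N : Matrix c c ℝ) (ξ η : Matrix d c ℝ) :
    weightedForm A N ξ η = trace (ηᵀ * A * ξ * N) := rfl

lemma weightedForm_comm {d c : Type*} [Fintype d] [Fintype c] {A : Matrix d d ℝ}
    {N : Matrix c c ℝ} (hA : Aᵀ = A) (hN : Nᵀ = N) (ξ η : Matrix d c ℝ) :
    weightedForm A N ξ η = weightedForm A N η ξ := by
  rw [weightedForm_apply, weightedForm_apply, ← trace_transpose]
  simp only [transpose_mul, transpose_transpose, hA, hN]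
  rw [trace_mul_comm]
  simp only [Matrix.mul_assoc]

lemma fderiv_form_self {E : Type*} [NormedAddCommGroup E] [NormedSpace ℝ E]
    [FiniteDimensional ℝ E] {H : LinearMap.BilinForm ℝ E} (hH : ∀ x y, H x y = H y x) (c : ℝ)
    (x y : E) : fderiv ℝ (fun x => c * H x x) x y = 2 * c * H x y := by
  let h : E →L[ℝ] E →L[ℝ] ℝ := LinearMap.toContinuousLinearMap
    (LinearMap.toContinuousLinearMap.toLinearMap ∘ₗ H)
  have h1 : HasFDerivAt (fun x => c * H x x) _ x :=
    (h.hasFDerivAt.clm_apply (hasFDerivAt_id x)).const_mul c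
  rw [h1.fderiv]
  have h2 : ∀ a b, h a b = H a b := fun a b => rfl
  simp only [_root_.smul_apply, _root_.add_apply,
    ContinuousLinearMap.comp_apply, ContinuousLinearMap.flip_apply, ContinuousLinearMap.id_apply,
    h2, id, smul_eq_mul, hH y x]
  ring

variable {dx dy p : ℕ} {Sxx : Matrix (Fin dx) (Fin dx) ℝ} {Syy : Matrix (Fin dy) (Fin dy) ℝ}
  {Sxy : Matrix (Fin dx) (Fin dy) ℝ}

/-- The symmetric matrix with off-diagonal blocks `Sxy` and its transpose. -/
def crossBlocks (Sxy : Matrix (Fin dx) (Fin dy) ℝ) :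
    Matrix (Fin dx ⊕ Fin dy) (Fin dx ⊕ Fin dy) ℝ :=
  fromBlocks 0 Sxy Sxyᵀ 0

lemma crossBlocks_transpose (Sxy : Matrix (Fin dx) (Fin dy) ℝ) :
    (crossBlocks Sxy)ᵀ = crossBlocks Sxy := by
  simp [crossBlocks, fromBlocks_transpose]

/-- The Euclidean gradient of the cost function. -/
noncomputable def costGradient (Sxy : Matrix (Fin dx) (Fin dy) ℝ) (μ : Fin p → ℝ) :
    Matrix (Fin dx ⊕ Fin dy) (Fin p) ℝ →ₗ[ℝ] Matrix (Fin dx ⊕ Fin dy) (Fin p) ℝ where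
  toFun Z := -(crossBlocks Sxy * Z * diagonal μ)
  map_add' Z W := by rw [Matrix.mul_add, Matrix.add_mul, neg_add]
  map_smul' c Z := by simp

lemma costGradient_apply (Sxy : Matrix (Fin dx) (Fin dy) ℝ) (μ : Fin p → ℝ)
    (Z : Matrix (Fin dx ⊕ Fin dy) (Fin p) ℝ) :
    costGradient Sxy μ Z = -(crossBlocks Sxy * Z * diagonal μ) := rfl

lemma cost_eq (Sxy : Matrix (Fin dx) (Fin dy) ℝ) (μ : Fin p → ℝ)
    (Z : Matrix (Fin dx ⊕ Fin dy) (Fin p) ℝ) :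
    cost Sxy μ Z = -(1 / 2) * weightedForm (crossBlocks Sxy) (diagonal μ) Z Z := rfl

lemma fderiv_cost (Sxy : Matrix (Fin dx) (Fin dy) ℝ) (μ : Fin p → ℝ)
    (Z η : Matrix (Fin dx ⊕ Fin dy) (Fin p) ℝ) :
    fderiv ℝ (cost Sxy μ) Z η = trace (ηᵀ * costGradient Sxy μ Z) := by
  have h := fderiv_form_self (weightedForm_comm (crossBlocks_transpose Sxy)
    (diagonal_transpose μ)) (-(1 / 2)) Z η
  refine Eq.trans h ?_
  rw [costGradient_apply, weightedForm_apply, Matrix.mul_neg, trace_neg]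
  simp only [Matrix.mul_assoc]
  ring

lemma multiplierTerm_eq (Z : Matrix (Fin dx ⊕ Fin dy) (Fin p) ℝ) (D : Matrix (Fin p) (Fin p) ℝ) :
    multiplierTerm Sxx Syy Z D D = blockDiag₂ Sxx Syy * Z * D := by
  conv_rhs => rw [← fromRows_toRows Z, blockDiag₂, fromBlocks_mul_fromRows, fromRows_mul]
  simp [multiplierTerm]

lemma blockDiag₂_transpose (hSxx : Sxxᵀ = Sxx) (hSyy : Syyᵀ = Syy) :
    (blockDiag₂ Sxx Syy)ᵀ = blockDiag₂ Sxx Syy := by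
  simp [blockDiag₂, fromBlocks_transpose, hSxx, hSyy]

/-- The bilinear form of the Hessian at a critical point with multipliers `-diag c`. -/
noncomputable def hessianForm (Sxx : Matrix (Fin dx) (Fin dx) ℝ) (Syy : Matrix (Fin dy) (Fin dy) ℝ)
    (Sxy : Matrix (Fin dx) (Fin dy) ℝ) (μ c : Fin p → ℝ) :
    LinearMap.BilinForm ℝ (Matrix (Fin dx ⊕ Fin dy) (Fin p) ℝ) :=
  weightedForm (blockDiag₂ Sxx Syy) (diagonal c) - weightedForm (crossBlocks Sxy) (diagonal μ)

lemma hessianForm_eq (μ c : Fin p → ℝ) (ξ η : Matrix (Fin dx ⊕ Fin dy) (Fin p) ℝ) :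
    trace (ηᵀ * (costGradient Sxy μ ξ -
      multiplierTerm Sxx Syy ξ (-diagonal c) (-diagonal c))) =
      hessianForm Sxx Syy Sxy μ c ξ η := by
  rw [multiplierTerm_eq, hessianForm, LinearMap.sub_apply, LinearMap.sub_apply,
    weightedForm_apply, weightedForm_apply, costGradient_apply]
  simp only [Matrix.mul_sub, Matrix.mul_neg, trace_sub, trace_neg, Matrix.mul_assoc]
  ring

lemma hessianForm_comm (hSxx : Sxxᵀ = Sxx) (hSyy : Syyᵀ = Syy) (μ c : Fin p → ℝ)
    (ξ η : Matrix (Fin dx ⊕ Fin dy) (Fin p) ℝ) :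
    hessianForm Sxx Syy Sxy μ c ξ η = hessianForm Sxx Syy Sxy μ c η ξ := by
  simp only [hessianForm, LinearMap.sub_apply]
  rw [weightedForm_comm (blockDiag₂_transpose hSxx hSyy) (diagonal_transpose c),
    weightedForm_comm (crossBlocks_transpose Sxy) (diagonal_transpose μ)]

variable {P : Matrix (Fin dx) (Fin dx) ℝ} {Q : Matrix (Fin dy) (Fin dy) ℝ}
  {S : Matrix (Fin dx) (Fin dy) ℝ}

lemma conj_block {d : ℕ} {B R : Matrix (Fin d) (Fin d) ℝ} (hR : Rᵀ * B * R = 1)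
    (a b : Matrix (Fin d) (Fin p) ℝ) : (R * a)ᵀ * B * (R * b) = aᵀ * b := by
  calc (R * a)ᵀ * B * (R * b) = aᵀ * (Rᵀ * B * R) * b := by
        simp only [transpose_mul, Matrix.mul_assoc]
    _ = aᵀ * b := by rw [hR, Matrix.mul_one]

lemma conj_cross (hS : Pᵀ * Sxy * Q = S) (a : Matrix (Fin dx) (Fin p) ℝ)
    (b : Matrix (Fin dy) (Fin p) ℝ) : (P * a)ᵀ * Sxy * (Q * b) = aᵀ * S * b := by
  rw [← hS]
  simp only [transpose_mul, Matrix.mul_assoc]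

lemma weightedForm_blockDiag₂ (hP : Pᵀ * Sxx * P = 1) (hQ : Qᵀ * Syy * Q = 1)
    (a : Matrix (Fin dx) (Fin p) ℝ) (b : Matrix (Fin dy) (Fin p) ℝ) (N : Matrix (Fin p) (Fin p) ℝ) :
    weightedForm (blockDiag₂ Sxx Syy) N (fromRows (P * a) (Q * b)) (fromRows (P * a) (Q * b)) =
      trace (aᵀ * a * N) + trace (bᵀ * b * N) := by
  rw [weightedForm_apply, Matrix.mul_assoc _ (blockDiag₂ Sxx Syy), blockDiag₂,
    fromBlocks_mul_fromRows, transpose_fromRows, fromCols_mul_fromRows, Matrix.add_mul, trace_add,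
    ← conj_block hP a a, ← conj_block hQ b b]
  simp only [Matrix.zero_mul, add_zero, zero_add, Matrix.mul_assoc]

lemma weightedForm_crossBlocks (hS : Pᵀ * Sxy * Q = S)
    (a : Matrix (Fin dx) (Fin p) ℝ) (b : Matrix (Fin dy) (Fin p) ℝ) (μ : Fin p → ℝ) :
    weightedForm (crossBlocks Sxy) (diagonal μ) (fromRows (P * a) (Q * b))
      (fromRows (P * a) (Q * b)) = 2 * trace (aᵀ * S * b * diagonal μ) := by
  rw [weightedForm_apply, Matrix.mul_assoc _ (crossBlocks Sxy), crossBlocks,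
    fromBlocks_mul_fromRows, transpose_fromRows, fromCols_mul_fromRows, Matrix.add_mul, trace_add,
    ← conj_cross hS a b]
  -- The two off-diagonal blocks contribute transposed matrices, hence equal traces.
  have : trace ((Q * b)ᵀ * (Sxyᵀ * (P * a) + (0 : Matrix (Fin dy) (Fin dy) ℝ) * (Q * b)) *
      diagonal μ) =
      trace ((P * a)ᵀ * Sxy * (Q * b) * diagonal μ) := by
    rw [← trace_transpose, trace_mul_comm _ (diagonal μ)]
    simp [transpose_mul, Matrix.mul_assoc]
  rw [this]
  simp only [Matrix.zero_mul, zero_add, Matrix.mul_assoc]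
  ring

end Forms


/-! ### The Hessian at a minimizer -/

section Minimizer

variable {dx dy p : ℕ} {Sxx : Matrix (Fin dx) (Fin dx) ℝ} {Syy : Matrix (Fin dy) (Fin dy) ℝ}
  {Sxy : Matrix (Fin dx) (Fin dy) ℝ} {μ s : ℕ → ℝ}

/-- `P` and `Q` are bases, orthonormal for `Sxx` and `Syy`, in which `Sxy` is rectangular
diagonal. -/
structure IsCanonicalBases (Sxx : Matrix (Fin dx) (Fin dx) ℝ) (Syy : Matrix (Fin dy) (Fin dy) ℝ)
    (Sxy : Matrix (Fin dx) (Fin dy) ℝ) (s : ℕ → ℝ) (P : Matrix (Fin dx) (Fin dx) ℝ)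
    (Q : Matrix (Fin dy) (Fin dy) ℝ) : Prop where
  left : Pᵀ * Sxx * P = 1
  right : Qᵀ * Syy * Q = 1
  cross : Pᵀ * Sxy * Q = rectDiagonal dx dy s

lemma eq_mul_coord {d : ℕ} {B R : Matrix (Fin d) (Fin d) ℝ} (hR : Rᵀ * B * R = 1)
    (X : Matrix (Fin d) (Fin p) ℝ) : R * (Rᵀ * B * X) = X := by
  rw [← Matrix.mul_assoc, mul_transpose_mul_eq_one hR, Matrix.one_mul]

lemma frame_mem_prodStiefel {P : Matrix (Fin dx) (Fin dx) ℝ} {Q : Matrix (Fin dy) (Fin dy) ℝ}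
    (hx : p ≤ dx) (hy : p ≤ dy) (h : IsCanonicalBases Sxx Syy Sxy s P Q) :
    fromRows (P * frame dx p) (Q * frame dy p) ∈ prodStiefel Sxx Syy p := by
  constructor
  · change (P * frame dx p)ᵀ * Sxx * (P * frame dx p) = 1
    rw [conj_block h.left, frame_orthonormal hx]
  · change (Q * frame dy p)ᵀ * Syy * (Q * frame dy p) = 1
    rw [conj_block h.right, frame_orthonormal hy]

/-- A minimizer consists of the first vectors of suitable canonical bases. -/
lemma exists_adapted_bases {P : Matrix (Fin dx) (Fin dx) ℝ} {Q : Matrix (Fin dy) (Fin dy) ℝ}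
    (hx : p ≤ dx) (hy : p ≤ dy) (hgap : IsGapped p μ s)
    (h : IsCanonicalBases Sxx Syy Sxy s P Q) {Z : Matrix (Fin dx ⊕ Fin dy) (Fin p) ℝ}
    (hZ : Z ∈ prodStiefel Sxx Syy p)
    (hmin : IsMinOn (cost Sxy fun k : Fin p => μ k) (prodStiefel Sxx Syy p) Z) :
    ∃ (P' : Matrix (Fin dx) (Fin dx) ℝ) (Q' : Matrix (Fin dy) (Fin dy) ℝ),
      IsCanonicalBases Sxx Syy Sxy s P' Q' ∧
      Z = fromRows (P' * frame dx p) (Q' * frame dy p) := by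
  obtain ⟨u, hu⟩ : ∃ u, P * u = Z.toRows₁ := ⟨_, eq_mul_coord h.left _⟩
  obtain ⟨v, hv⟩ : ∃ v, Q * v = Z.toRows₂ := ⟨_, eq_mul_coord h.right _⟩
  have hZuv : Z = fromRows (P * u) (Q * v) := by rw [hu, hv, fromRows_toRows]
  have hu1 : uᵀ * u = 1 := by
    rw [← conj_block h.left, hu]
    exact hZ.1
  have hv1 : vᵀ * v = 1 := by
    rw [← conj_block h.right, hv]
    exact hZ.2
  -- Comparison with the first canonical vectors shows that `Z` reaches the upper bound of the trace
  -- inequality.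
  have hle := isMinOn_iff.1 hmin _ (frame_mem_prodStiefel hx hy h)
  rw [hZuv, cost_eq, cost_eq, weightedForm_crossBlocks h.cross, weightedForm_crossBlocks h.cross,
    trace_frame_rectDiagonal hx hy] at hle
  obtain ⟨ε, hε, hue, hve⟩ := eq_frame_of_trace_ge hx hy hgap hu1 hv1 (by linarith)
  have hεε : ∀ d : ℕ, diagonal (fun i : Fin d => ε i) * diagonal (fun i : Fin d => ε i) = 1 := by
    intro d
    rw [diagonal_mul_diagonal, ← diagonal_one]
    congr 1
    ext i
    exact hε i
  -- The signs are absorbed into both bases; being common, they cancel in the diagonal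
  -- cross-covariance.
  refine ⟨P * diagonal fun i : Fin dx => ε i, Q * diagonal fun i : Fin dy => ε i, ⟨?_, ?_, ?_⟩, ?_⟩
  · rw [conj_block h.left, diagonal_transpose, hεε]
  · rw [conj_block h.right, diagonal_transpose, hεε]
  · have : (P * diagonal fun i : Fin dx => ε i)ᵀ * Sxy * (Q * diagonal fun i : Fin dy => ε i) =
        (diagonal fun i : Fin dx => ε i) * (Pᵀ * Sxy * Q) * diagonal fun i : Fin dy => ε i := by
      simp only [transpose_mul, diagonal_transpose, Matrix.mul_assoc]
    rw [this, h.cross]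
    ext i j
    rw [mul_diagonal, diagonal_mul, rectDiagonal_apply]
    split_ifs with hij
    · rw [← hij]
      linear_combination s i * hε i
    · simp
  · rw [hZuv, Matrix.mul_assoc, Matrix.mul_assoc, ← hue, ← hve]

variable {P : Matrix (Fin dx) (Fin dx) ℝ} {Q : Matrix (Fin dy) (Fin dy) ℝ}

lemma IsCanonicalBases.swap (h : IsCanonicalBases Sxx Syy Sxy s P Q) :
    IsCanonicalBases Syy Sxx Sxyᵀ s Q P := by
  refine ⟨h.right, h.left, ?_⟩
  have : Qᵀ * Sxyᵀ * P = (Pᵀ * Sxy * Q)ᵀ := by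
    simp only [transpose_mul, transpose_transpose, Matrix.mul_assoc]
  rw [this, h.cross]
  ext i j
  exact rectDiagonal_symm s j i

/-- In canonical bases `Sxy * Q = Sxx * P * rectDiagonal`, so `Sxy` sends the k-th vector of `Q` to
`s k` times `Sxx` applied to that of `P`. The multipliers are read off from this. -/
lemma IsCanonicalBases.critical_block (hy : p ≤ dy) (h : IsCanonicalBases Sxx Syy Sxy s P Q) :
    Sxy * (Q * frame dy p) * diagonal (fun k : Fin p => μ k) =
      Sxx * (P * frame dx p) * diagonal fun k : Fin p => μ k * s k := by
  have h1 : Sxy * Q = Sxx * P * rectDiagonal dx dy s := by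
    rw [← h.cross, Matrix.mul_assoc Pᵀ, ← Matrix.mul_assoc, mul_mul_transpose_eq_one h.left,
      Matrix.one_mul]
  have h2 : rectDiagonal dx dy s * frame dy p * diagonal (fun k : Fin p => μ k) =
      frame dx p * diagonal fun k : Fin p => μ k * s k := by
    ext i k
    rw [mul_diagonal, mul_diagonal, rectDiagonal_mul_frame hy, frame_apply]
    split_ifs <;> ring
  calc Sxy * (Q * frame dy p) * diagonal (fun k : Fin p => μ k)
      = Sxx * P * (rectDiagonal dx dy s * frame dy p * diagonal (fun k : Fin p => μ k)) := by
        rw [← Matrix.mul_assoc, h1]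
        simp only [Matrix.mul_assoc]
    _ = _ := by
        rw [h2]
        simp only [Matrix.mul_assoc]

lemma IsCanonicalBases.critical (hx : p ≤ dx) (hy : p ≤ dy)
    (h : IsCanonicalBases Sxx Syy Sxy s P Q) :
    costGradient Sxy (fun k : Fin p => μ k) (fromRows (P * frame dx p) (Q * frame dy p)) =
      multiplierTerm Sxx Syy (fromRows (P * frame dx p) (Q * frame dy p))
        (-diagonal fun k : Fin p => μ k * s k) (-diagonal fun k : Fin p => μ k * s k) := by
  rw [costGradient_apply, crossBlocks, fromBlocks_mul_fromRows, fromRows_mul, multiplierTerm, toRows₁_fromRows,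
    toRows₂_fromRows, Matrix.mul_neg, Matrix.mul_neg, ← h.critical_block hy,
    ← h.swap.critical_block hx]
  ext (i | i) j <;> simp

/-- In a `B`-orthonormal basis that starts with the given frame, tangency says that the leading
square of coordinates is skew; the other rows are free. -/
lemma mul_mem_genStiefelTangent_iff {d : ℕ} (hd : p ≤ d) {B R : Matrix (Fin d) (Fin d) ℝ}
    (hR : Rᵀ * B * R = 1) (a : Matrix (Fin d) (Fin p) ℝ) :
    R * a ∈ genStiefelTangent B (R * frame d p) ↔
      ∀ k l : Fin p, zeroExt a k l + zeroExt a l k = 0 := by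
  have h1 : ∀ k l : Fin p, ((R * a)ᵀ * B * (R * frame d p) + (R * frame d p)ᵀ * B * (R * a)) k l =
      zeroExt a k l + zeroExt a l k := by
    intro k l
    have e : ∀ k l : Fin p, zeroExt a k l = a (Fin.castLE hd k) l := fun k l =>
      zeroExt_coe a (Fin.castLE hd k) l
    rw [conj_block hR, conj_block hR, Matrix.add_apply, mul_frame_apply hd,
      frame_transpose_mul_apply hd, e, e, transpose_apply, add_comm]
  constructor
  · intro h k l
    rw [← h1]
    exact congrFun (congrFun h k) l
  · intro h
    change _ + _ = (0 : Matrix (Fin p) (Fin p) ℝ)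
    ext k l
    rw [h1, h, Matrix.zero_apply]

lemma IsCanonicalBases.mem_tangent_iff (hx : p ≤ dx) (hy : p ≤ dy)
    (h : IsCanonicalBases Sxx Syy Sxy s P Q) (a : Matrix (Fin dx) (Fin p) ℝ)
    (b : Matrix (Fin dy) (Fin p) ℝ) :
    fromRows (P * a) (Q * b) ∈
        prodStiefelTangent Sxx Syy (fromRows (P * frame dx p) (Q * frame dy p)) ↔
      (∀ k l : Fin p, zeroExt a k l + zeroExt a l k = 0) ∧
        ∀ k l : Fin p, zeroExt b k l + zeroExt b l k = 0 :=
  and_congr (mul_mem_genStiefelTangent_iff hx h.left a) (mul_mem_genStiefelTangent_iff hy h.right b)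

lemma IsCanonicalBases.hessianForm_eq_coordForm (h : IsCanonicalBases Sxx Syy Sxy s P Q)
    (a : Matrix (Fin dx) (Fin p) ℝ) (b : Matrix (Fin dy) (Fin p) ℝ) :
    hessianForm Sxx Syy Sxy (fun k : Fin p => μ k) (fun k : Fin p => μ k * s k)
        (fromRows (P * a) (Q * b)) (fromRows (P * a) (Q * b)) =
      coordForm (max dx dy) μ s (zeroExt a) (zeroExt b) := by
  rw [← coordForm_zeroExt (le_max_left dx dy) (le_max_right dx dy), hessianForm,
    LinearMap.sub_apply, LinearMap.sub_apply, weightedForm_blockDiag₂ h.left h.right,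
    weightedForm_crossBlocks h.cross]

lemma IsCanonicalBases.metric_eq_coordNormSq (h : IsCanonicalBases Sxx Syy Sxy s P Q)
    (a : Matrix (Fin dx) (Fin p) ℝ) (b : Matrix (Fin dy) (Fin p) ℝ) :
    metric (blockDiag₂ Sxx Syy) (fromRows (P * a) (Q * b)) (fromRows (P * a) (Q * b)) =
      coordNormSq (max dx dy) (zeroExt a) (zeroExt b) := by
  have := weightedForm_blockDiag₂ h.left h.right a b 1
  simp only [weightedForm_apply, Matrix.mul_one] at this
  rw [← coordNormSq_zeroExt (le_max_left dx dy) (le_max_right dx dy), ← this, metric]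

/-! ### Tangent directions for the extreme Rayleigh quotients -/

lemma skew_rowTest (d : ℕ) (τ : ℝ) (k i j : Fin p) :
    zeroExt (rowTest p d τ k) i j + zeroExt (rowTest p d τ k) j i = 0 := by
  have h1 : (i : ℕ) ≠ p := by omega
  have h2 : (j : ℕ) ≠ p := by omega
  simp [zeroExt_rowTest, h1, h2]

lemma skew_pairTest {d : ℕ} (hd : p ≤ d) (τ : ℝ) {i k : Fin p} (hik : i ≠ k) (j l : Fin p) :
    zeroExt (pairTest d τ i k) j l + zeroExt (pairTest d τ i k) l j = 0 := by
  simp only [zeroExt_pairTest hd, ← Fin.ext_iff]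
  by_cases h1 : j = i <;> by_cases h2 : l = k <;> by_cases h3 : j = k <;> by_cases h4 : l = i <;>
    simp_all

variable {M S : ℕ → ℝ}

/-- The Rayleigh quotients of the Hessian form on the tangent space at a minimizer lie between
the denominator and the numerator of the baseline condition number. -/
lemma IsCanonicalBases.hessianForm_bounds (hp : 1 ≤ p) (hx : p ≤ dx) (hy : p ≤ dy)
    (hgap : IsGapped p (fun k => M (k + 1)) fun i => S (i + 1))
    (h : IsCanonicalBases Sxx Syy Sxy (fun i => S (i + 1)) P Q)
    {ξ : Matrix (Fin dx ⊕ Fin dy) (Fin p) ℝ}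
    (hξ : ξ ∈ prodStiefelTangent Sxx Syy (fromRows (P * frame dx p) (Q * frame dy p))) :
    kappaStarDen p M S * metric (blockDiag₂ Sxx Syy) ξ ξ ≤
        hessianForm Sxx Syy Sxy (fun k : Fin p => M (k + 1))
          (fun k : Fin p => M (k + 1) * S (k + 1)) ξ ξ ∧
      hessianForm Sxx Syy Sxy (fun k : Fin p => M (k + 1))
          (fun k : Fin p => M (k + 1) * S (k + 1)) ξ ξ ≤
        kappaStarNum p M S * metric (blockDiag₂ Sxx Syy) ξ ξ := by
  obtain ⟨a, ha⟩ : ∃ a, P * a = ξ.toRows₁ := ⟨_, eq_mul_coord h.left _⟩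
  obtain ⟨b, hb⟩ : ∃ b, Q * b = ξ.toRows₂ := ⟨_, eq_mul_coord h.right _⟩
  obtain rfl : ξ = fromRows (P * a) (Q * b) := by rw [ha, hb, fromRows_toRows]
  obtain ⟨hα, hβ⟩ := (h.mem_tangent_iff hx hy a b).1 hξ
  have hD : p ≤ max dx dy := hx.trans (le_max_left _ _)
  have e := h.hessianForm_eq_coordForm (μ := fun k => M (k + 1)) a b
  rw [e, h.metric_eq_coordNormSq]
  exact ⟨le_coordForm hD hgap hα hβ (kappaStarDen_le_row hgap) (kappaStarDen_le_pair hgap),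
    coordForm_le hD hgap hα hβ (row_le_kappaStarNum hp hgap) (pair_le_kappaStarNum hgap)⟩

lemma IsCanonicalBases.exists_tangent_row (hx : p ≤ dx) (hy : p ≤ dy) (hmax : p < max dx dy)
    (hs : p = min dx dy → S (p + 1) = 0)
    (h : IsCanonicalBases Sxx Syy Sxy (fun i => S (i + 1)) P Q) (k : Fin p) {τ : ℝ}
    (hτ : τ ^ 2 = 1) :
    ∃ ξ ∈ prodStiefelTangent Sxx Syy (fromRows (P * frame dx p) (Q * frame dy p)),
      0 < metric (blockDiag₂ Sxx Syy) ξ ξ ∧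
      hessianForm Sxx Syy Sxy (fun k : Fin p => M (k + 1))
          (fun k : Fin p => M (k + 1) * S (k + 1)) ξ ξ =
        M (k + 1) * (S (k + 1) - τ * S (p + 1)) * metric (blockDiag₂ Sxx Syy) ξ ξ := by
  obtain ⟨h1, h2⟩ := coordForm_rowTest (μ := fun k => M (k + 1)) (s := fun i => S (i + 1)) hmax
    (fun h1 => or_iff_not_imp_left.2 fun h2 => hs (by omega))
    (fun h1 => or_iff_not_imp_left.2 fun h2 => hs (by omega)) k hτ
  refine ⟨fromRows (P * rowTest p dx 1 k) (Q * rowTest p dy τ k),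
    (h.mem_tangent_iff hx hy _ _).2 ⟨skew_rowTest dx 1 k, skew_rowTest dy τ k⟩, ?_, ?_⟩
  · rwa [h.metric_eq_coordNormSq]
  · have e := h.hessianForm_eq_coordForm (μ := fun k => M (k + 1)) (rowTest p dx 1 k)
      (rowTest p dy τ k)
    rw [e, h.metric_eq_coordNormSq, h1]

lemma IsCanonicalBases.exists_tangent_pair (hx : p ≤ dx) (hy : p ≤ dy)
    (h : IsCanonicalBases Sxx Syy Sxy (fun i => S (i + 1)) P Q) {i k : Fin p} (hik : i ≠ k) {τ : ℝ}
    (hτ : τ ^ 2 = 1) :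
    ∃ ξ ∈ prodStiefelTangent Sxx Syy (fromRows (P * frame dx p) (Q * frame dy p)),
      0 < metric (blockDiag₂ Sxx Syy) ξ ξ ∧
      hessianForm Sxx Syy Sxy (fun k : Fin p => M (k + 1))
          (fun k : Fin p => M (k + 1) * S (k + 1)) ξ ξ =
        1 / 2 * (M (i + 1) * S (i + 1) + M (k + 1) * S (k + 1) -
          τ * (M (i + 1) * S (k + 1) + M (k + 1) * S (i + 1))) *
            metric (blockDiag₂ Sxx Syy) ξ ξ := by
  obtain ⟨h1, h2⟩ := coordForm_pairTest (μ := fun k => M (k + 1)) (s := fun i => S (i + 1)) hx hy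
    hik hτ
  refine ⟨fromRows (P * pairTest dx 1 i k) (Q * pairTest dy τ i k),
    (h.mem_tangent_iff hx hy _ _).2 ⟨skew_pairTest hx 1 hik, skew_pairTest hy τ hik⟩, ?_, ?_⟩
  · rwa [h.metric_eq_coordNormSq]
  · have e := h.hessianForm_eq_coordForm (μ := fun k => M (k + 1)) (pairTest dx 1 i k)
      (pairTest dy τ i k)
    rw [e, h.metric_eq_coordNormSq, h1]

/-- The lower bound for the Rayleigh quotients is attained. -/
lemma IsCanonicalBases.exists_hessianForm_le (hp : 1 ≤ p) (hx : p ≤ dx) (hy : p ≤ dy)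
    (hmax : p < max dx dy) (hs : p = min dx dy → S (p + 1) = 0)
    (h : IsCanonicalBases Sxx Syy Sxy (fun i => S (i + 1)) P Q) :
    ∃ ξ ∈ prodStiefelTangent Sxx Syy (fromRows (P * frame dx p) (Q * frame dy p)),
      0 < metric (blockDiag₂ Sxx Syy) ξ ξ ∧
      hessianForm Sxx Syy Sxy (fun k : Fin p => M (k + 1))
          (fun k : Fin p => M (k + 1) * S (k + 1)) ξ ξ ≤
        kappaStarDen p M S * metric (blockDiag₂ Sxx Syy) ξ ξ := by
  rcases kappaStarDen_attained p M S with hle | ⟨j, hj1, hj2, hle⟩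
  -- The minimum sits in the last column, with zero-based index `p - 1`.
  · obtain ⟨ξ, hξ, hpos, he⟩ := h.exists_tangent_row (M := M) hx hy hmax hs ⟨p - 1, by omega⟩
      (τ := 1) (by norm_num)
    refine ⟨ξ, hξ, hpos, ?_⟩
    simp only [Nat.sub_add_cancel hp, one_mul] at he
    rw [he]
    exact mul_le_mul_of_nonneg_right hle hpos.le
  · obtain ⟨ξ, hξ, hpos, he⟩ := h.exists_tangent_pair (M := M) hx hy (i := ⟨j - 1, by omega⟩)
      (k := ⟨j, hj2⟩) (by rw [Ne, Fin.mk.injEq]; omega) (τ := 1) (by norm_num)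
    refine ⟨ξ, hξ, hpos, ?_⟩
    simp only [Nat.sub_add_cancel hj1] at he
    rw [he]
    refine mul_le_mul_of_nonneg_right (le_trans (le_of_eq ?_) hle) hpos.le
    ring

/-- The upper bound for the Rayleigh quotients is attained. -/
lemma IsCanonicalBases.exists_le_hessianForm (hp : 1 ≤ p) (hx : p ≤ dx) (hy : p ≤ dy)
    (hmax : p < max dx dy) (hs : p = min dx dy → S (p + 1) = 0)
    (h : IsCanonicalBases Sxx Syy Sxy (fun i => S (i + 1)) P Q) :
    ∃ ξ ∈ prodStiefelTangent Sxx Syy (fromRows (P * frame dx p) (Q * frame dy p)),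
      0 < metric (blockDiag₂ Sxx Syy) ξ ξ ∧
      kappaStarNum p M S * metric (blockDiag₂ Sxx Syy) ξ ξ ≤
        hessianForm Sxx Syy Sxy (fun k : Fin p => M (k + 1))
          (fun k : Fin p => M (k + 1) * S (k + 1)) ξ ξ := by
  rcases kappaStarNum_attained p M S with hle | ⟨hp2, hle⟩
  · obtain ⟨ξ, hξ, hpos, he⟩ := h.exists_tangent_row (M := M) hx hy hmax hs ⟨0, hp⟩
      (τ := -1) (by norm_num)
    refine ⟨ξ, hξ, hpos, ?_⟩
    rw [he]
    refine mul_le_mul_of_nonneg_right (hle.trans (le_of_eq ?_)) hpos.le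
    simp
  · obtain ⟨ξ, hξ, hpos, he⟩ := h.exists_tangent_pair (M := M) hx hy (i := ⟨0, hp⟩)
      (k := ⟨1, hp2⟩) (by rw [Ne, Fin.mk.injEq]; omega) (τ := -1) (by norm_num)
    refine ⟨ξ, hξ, hpos, ?_⟩
    rw [he]
    refine mul_le_mul_of_nonneg_right (hle.trans (le_of_eq ?_)) hpos.le
    simp only [zero_add, one_add_one_eq_two]
    ring

end Minimizer

/-! ### Pencils of positive definite matrices -/

section Pencil

variable {d : Type*} [Fintype d]

/-- The bilinear form `v ⬝ᵥ A *ᵥ w`. -/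
noncomputable def vecForm (A : Matrix d d ℝ) : LinearMap.BilinForm ℝ (d → ℝ) :=
  LinearMap.mk₂ ℝ (fun v w => w ⬝ᵥ A *ᵥ v)
    (by intros; simp [mulVec_add])
    (by intros; simp [mulVec_smul])
    (by intros; simp)
    (by intros; simp)

lemma vecForm_apply (A : Matrix d d ℝ) (v w : d → ℝ) : vecForm A v w = w ⬝ᵥ A *ᵥ v := rfl

lemma vecForm_comm {A : Matrix d d ℝ} (hA : Aᵀ = A) (v w : d → ℝ) :
    vecForm A v w = vecForm A w v := by
  rw [vecForm_apply, vecForm_apply, dotProduct_mulVec, ← mulVec_transpose, hA, dotProduct_comm]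

/-- A vector equation is equivalent to its pairings with all vectors; definiteness of `B` turns `B
*ᵥ v ≠ 0` into `v ≠ 0`. -/
lemma pencilEigenvalues_eq {A B : Matrix d d ℝ} (hB : B.PosDef) :
    pencilEigenvalues A B = formEigenvalues ⊤ (vecForm A) (vecForm B) := by
  ext l
  refine exists_congr fun v => ?_
  have h1 : B *ᵥ v ≠ 0 ↔ v ≠ 0 := by
    refine ⟨fun h hv => h (by rw [hv, mulVec_zero]), fun h hv => ?_⟩
    have := hB.dotProduct_mulVec_pos h
    rw [hv] at this
    simp at this
  have h2 : A *ᵥ v = l • (B *ᵥ v) ↔ ∀ w ∈ (⊤ : Submodule ℝ (d → ℝ)),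
      vecForm A v w = l * vecForm B v w := by
    simp only [vecForm_apply]
    refine ⟨fun h w _ => by rw [h, dotProduct_smul, smul_eq_mul], fun h => ?_⟩
    refine dotProduct_eq _ _ fun w => ?_
    have := h w trivial
    rw [dotProduct_comm, this, smul_dotProduct, smul_eq_mul, dotProduct_comm w]
  rw [h1, h2]
  simp

/-- The generalized eigenvalues of a pencil of positive definite matrices have a smallest and a
largest element, which compare the two metrics. -/
lemma exists_pencil_bounds [Nonempty d] {A B : Matrix d d ℝ} (hA : A.PosDef) (hB : B.PosDef) :
    ∃ lo hi, IsLeast (pencilEigenvalues A B) lo ∧ IsGreatest (pencilEigenvalues A B) hi ∧ 0 < lo ∧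
      ∀ {c : Type} [Fintype c] (ξ : Matrix d c ℝ),
        lo * metric B ξ ξ ≤ metric A ξ ξ ∧ metric A ξ ξ ≤ hi * metric B ξ ξ := by
  have hT : (⊤ : Submodule ℝ (d → ℝ)) ≠ ⊥ := top_ne_bot
  have hA' := vecForm_comm (A := A) (by simpa using hA.isHermitian.eq)
  have hB' := vecForm_comm (A := B) (by simpa using hB.isHermitian.eq)
  have hpos : ∀ x ∈ (⊤ : Submodule ℝ (d → ℝ)), x ≠ 0 → 0 < vecForm B x x := fun x _ hx => by
    simpa [vecForm_apply] using hB.dotProduct_mulVec_pos hx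
  obtain ⟨lo, hlo, hlo'⟩ := exists_isLeast_formEigenvalues hT hA' hB' hpos
  obtain ⟨hi, hhi, hhi'⟩ := exists_isGreatest_formEigenvalues hT hA' hB' hpos
  rw [← pencilEigenvalues_eq hB] at hlo hhi
  refine ⟨lo, hi, hlo, hhi, ?_, fun ξ => ?_⟩
  · have h := hlo.1
    rw [pencilEigenvalues_eq hB] at h
    obtain ⟨v, hv, hv0, hl⟩ := h
    have h1 := hl v hv
    have h2 : 0 < vecForm A v v := by
      simpa [vecForm_apply] using hA.dotProduct_mulVec_pos hv0
    rw [h1] at h2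
    exact (pos_iff_pos_of_mul_pos h2).2 (hpos v hv hv0)
  -- The metric is a sum over columns, so the vector inequality applies to each column.
  · simp only [metric_eq_sum, Finset.mul_sum]
    exact ⟨Finset.sum_le_sum fun k _ => hlo' (ξ.col k) trivial,
      Finset.sum_le_sum fun k _ => hhi' (ξ.col k) trivial⟩

end Pencil

lemma posDef_blockDiag₂ {dx dy : ℕ} {A : Matrix (Fin dx) (Fin dx) ℝ}
    {B : Matrix (Fin dy) (Fin dy) ℝ} (hA : A.PosDef) (hB : B.PosDef) :
    (blockDiag₂ A B).PosDef := by
  refine PosDef.of_dotProduct_mulVec_pos ?_ fun x hx => ?_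
  · exact isHermitian_fromBlocks_iff.2 ⟨hA.isHermitian, by simp, by simp, hB.isHermitian⟩
  · rw [← Sum.elim_comp_inl_inr x] at hx ⊢
    rw [blockDiag₂, fromBlocks_mulVec, star_trivial, sumElim_dotProduct_sumElim]
    simp only [Sum.elim_comp_inl, Sum.elim_comp_inr, zero_mulVec, add_zero, zero_add]
    by_cases h : x ∘ Sum.inl = 0
    · have h' : x ∘ Sum.inr ≠ 0 := fun h' => hx (by rw [h, h']; ext (i | i) <;> rfl)
      rw [h, zero_dotProduct, zero_add]
      simpa using hB.dotProduct_mulVec_pos h'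
    · have h1 := hA.dotProduct_mulVec_pos h
      have h2 := hB.posSemidef.dotProduct_mulVec_nonneg (x ∘ Sum.inr)
      simp only [star_trivial] at h1 h2
      exact add_pos_of_pos_of_nonneg h1 h2


/-! ### The condition number of the Hessian -/

/-- The zero default of `term` supplies both the value `μ p = 0` after the last weight and the
correlations beyond the smaller dimension. -/
lemma isGapped_term {m p : ℕ} {μ : Fin p → ℝ} (hμ : StrictAnti μ) (hμ_pos : ∀ i, 0 < μ i)
    {σ : Fin m → ℝ} (hσ : Antitone σ) (hσ_nonneg : ∀ i, 0 ≤ σ i)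
    (hgap : ∀ k, 1 ≤ k → k ≤ p → term σ (k + 1) < term σ k) :
    IsGapped p (fun k => term μ (k + 1)) fun i => term σ (i + 1) where
  mu_lt j hj := by
    rcases Nat.lt_or_ge (j + 1) p with h | h
    · have : (⟨j, hj⟩ : Fin p) < ⟨j + 1, h⟩ := Fin.mk_lt_mk.2 (Nat.lt_succ_self j)
      simpa [term, Nat.succ_le_of_lt h, hj] using hμ this
    · have h' : ¬ j + 1 + 1 ≤ p := by omega
      simpa [term, h', hj] using hμ_pos ⟨j, hj⟩
  mu_last := by simp [term]
  s_lt j hj := hgap (j + 1) (by omega) hj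
  s_nonneg i := by
    unfold term
    split_ifs
    exacts [hσ_nonneg _, le_rfl]
  s_le i hi := by
    by_cases h : i + 1 ≤ m
    · have h' : p + 1 ≤ m := by omega
      have : (⟨p, h'⟩ : Fin m) ≤ ⟨i, h⟩ := Fin.mk_le_mk.2 hi
      simpa [term, h, h'] using hσ this
    · have h0 : term σ (i + 1) = 0 := by simp [term, h]
      rw [h0]
      unfold term
      split_ifs
      exacts [hσ_nonneg _, le_rfl]

/-- The condition number of the Riemannian Hessian at the first vectors of canonical bases. -/
theorem hasConditionNumber_hessian {dx dy p : ℕ} {Sxx : Matrix (Fin dx) (Fin dx) ℝ}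
    {Syy : Matrix (Fin dy) (Fin dy) ℝ} {Sxy : Matrix (Fin dx) (Fin dy) ℝ} {m s : ℕ → ℝ}
    {P : Matrix (Fin dx) (Fin dx) ℝ} {Q : Matrix (Fin dy) (Fin dy) ℝ}
    (hp : 1 ≤ p) (hx : p ≤ dx) (hy : p ≤ dy) (hmax : p < max dx dy)
    (hSxx : Sxx.PosDef) (hSyy : Syy.PosDef)
    {M : Matrix (Fin dx ⊕ Fin dy) (Fin dx ⊕ Fin dy) ℝ} (hM : M.PosDef)
    (hgap : IsGapped p (fun k => m (k + 1)) fun i => s (i + 1)) (hs : p = min dx dy → s (p + 1) = 0)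
    (h : IsCanonicalBases Sxx Syy Sxy (fun i => s (i + 1)) P Q) :
    ∃ κH κP : ℝ,
      HasConditionNumber
        (riemannianHessianEigenvalues M (prodStiefelTangent Sxx Syy)
          (cost Sxy fun k : Fin p => m (k + 1))
          (fromRows (P * frame dx p) (Q * frame dy p))) κH ∧
      HasConditionNumber (pencilEigenvalues (blockDiag₂ Sxx Syy) M) κP ∧
      κH ≤ kappaStar p m s * κP ∧
      (M = blockDiag₂ Sxx Syy → κH = kappaStar p m s) := by
  have hSxx' : Sxxᵀ = Sxx := by simpa using hSxx.isHermitian.eq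
  have hSyy' : Syyᵀ = Syy := by simpa using hSyy.isHermitian.eq
  have hSig := posDef_blockDiag₂ hSxx hSyy
  have hsymm := hessianForm_comm (Sxy := Sxy) hSxx' hSyy' (fun k : Fin p => m (k + 1))
    fun k : Fin p => m (k + 1) * s (k + 1)
  have hlow := fun ξ hξ => (h.hessianForm_bounds (M := m) hp hx hy hgap (ξ := ξ) hξ).1
  have hupp := fun ξ hξ => (h.hessianForm_bounds (M := m) hp hx hy hgap (ξ := ξ) hξ).2
  obtain ⟨ξ₁, hξ₁, hpos₁, hξ₁'⟩ := h.exists_hessianForm_le (M := m) hp hx hy hmax hs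
  obtain ⟨ξ₂, hξ₂, hpos₂, hξ₂'⟩ := h.exists_le_hessianForm (M := m) hp hx hy hmax hs
  have hden := kappaStarDen_pos hp hgap
  have hcrit := h.critical (μ := fun k => m (k + 1)) hx hy
  have heig := riemannianHessianEigenvalues_eq hM fun ξ => by
    have := riemannianHessian_spec hM hSxx' hSyy' (fderiv_cost Sxy fun k : Fin p => m (k + 1))
      (frame_mem_prodStiefel hx hy h) (by simp) (by simp) hcrit ξ
    simpa only [hessianForm_eq] using this
  set Z := fromRows (P * frame dx p) (Q * frame dy p)
  set T := prodStiefelTangent Sxx Syy Z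
  set H := hessianForm Sxx Syy Sxy (fun k : Fin p => m (k + 1))
    fun k : Fin p => m (k + 1) * s (k + 1)
  have hT : T ≠ ⊥ := by
    intro hbot
    rw [hbot, Submodule.mem_bot] at hξ₁
    rw [hξ₁] at hpos₁
    simp [metric] at hpos₁
  have hne : ∀ {ξ : Matrix (Fin dx ⊕ Fin dy) (Fin p) ℝ}, 0 < metric (blockDiag₂ Sxx Syy) ξ ξ →
      0 < metric M ξ ξ := by
    intro ξ hξ
    refine metric_pos hM ?_
    rintro rfl
    simp [metric] at hξ
  obtain ⟨lo, hlo, hlo'⟩ := exists_isLeast_formEigenvalues (g := metricForm M) hT hsymm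
    (metric_comm hM) fun ξ _ => metric_pos hM
  obtain ⟨hi, hhi, hhi'⟩ := exists_isGreatest_formEigenvalues (g := metricForm M) hT hsymm
    (metric_comm hM) fun ξ _ => metric_pos hM
  have : Nonempty (Fin dx ⊕ Fin dy) := ⟨Sum.inl ⟨0, by omega⟩⟩
  obtain ⟨a, b, ha, hb, ha0, hab⟩ := exists_pencil_bounds hSig hM
  -- At an eigenvector for `lo`, the bound against the Σ-metric is chained with the bound of the
  -- Σ-metric against `M`.
  have hlo_ge : kappaStarDen p m s * a ≤ lo := by
    obtain ⟨ξ, hξ, hξ0, hl⟩ := hlo.1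
    have h1 := hl ξ hξ
    rw [metricForm_apply] at h1
    have h2 := hlow ξ hξ
    rw [h1] at h2
    have h3 := mul_le_mul_of_nonneg_left (hab ξ).1 hden.le
    exact le_of_mul_le_mul_right (by linarith) (metric_pos hM hξ0)
  have hlo_pos : 0 < lo := (mul_pos hden ha0).trans_le hlo_ge
  -- A single nonzero tangent vector squeezed between both bounds shows that the numerator is at
  -- least the positive denominator.
  have hnum : 0 ≤ kappaStarNum p m s := by
    have h1 := (mul_le_mul_of_nonneg_right (le_refl (kappaStarDen p m s)) hpos₁.le).trans
      ((hlow ξ₁ hξ₁).trans (hupp ξ₁ hξ₁))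
    exact hden.le.trans (le_of_mul_le_mul_right h1 hpos₁)
  have hhi_le : hi ≤ kappaStarNum p m s * b := by
    obtain ⟨ξ, hξ, hξ0, hl⟩ := hhi.1
    have h1 := hl ξ hξ
    rw [metricForm_apply] at h1
    have h2 := hupp ξ hξ
    rw [h1] at h2
    have h3 := mul_le_mul_of_nonneg_left (hab ξ).2 hnum
    exact le_of_mul_le_mul_right (by linarith) (metric_pos hM hξ0)
  have hb0 : 0 < b := ha0.trans_le (ha.2 hb.1)
  refine ⟨hi / lo, b / a, ?_, hasConditionNumber_of_isLeast ha hb ha0, ?_, fun hMS => ?_⟩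
  · rw [heig]
    exact hasConditionNumber_of_isLeast hlo hhi hlo_pos
  · rw [kappaStar, div_mul_div_comm]
    exact div_le_div₀ (mul_nonneg hnum hb0.le) hhi_le (mul_pos hden ha0) hlo_ge
  · subst hMS
    -- For `M = Σ` the pencil no longer intervenes: `ξ₁` attains the lower bound, so it is the least
    -- eigenvalue; likewise `ξ₂` for the upper one.
    have e1 : lo = kappaStarDen p m s := by
      refine le_antisymm (le_of_mul_le_mul_right ((hlo' ξ₁ hξ₁).trans hξ₁') hpos₁) ?_
      obtain ⟨ξ, hξ, hξ0, hl⟩ := hlo.1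
      have h1 := hlow ξ hξ
      rw [hl ξ hξ] at h1
      exact le_of_mul_le_mul_right h1 (metric_pos hM hξ0)
    have e2 : hi = kappaStarNum p m s := by
      refine le_antisymm ?_ (le_of_mul_le_mul_right (hξ₂'.trans (hhi' ξ₂ hξ₂)) hpos₂)
      obtain ⟨ξ, hξ, hξ0, hl⟩ := hhi.1
      have h1 := hupp ξ hξ
      rw [hl ξ hξ] at h1
      exact le_of_mul_le_mul_right h1 (metric_pos hM hξ0)
    rw [e1, e2, kappaStar]

end CCA

theorem mainTheorem1 (n dx dy p : ℕ) (hp : 1 ≤ p) (hp_min : p ≤ min dx dy)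
    (hp_max : p < max dx dy)
    (X : Matrix (Fin n) (Fin dx) ℝ) (Y : Matrix (Fin n) (Fin dy) ℝ)
    (lx ly : ℝ) (hlx : 0 ≤ lx) (hly : 0 ≤ ly)
    (hS : (CCA.blockDiag₂ (CCA.gram X lx) (CCA.gram Y ly)).PosDef)
    (Mxx : Matrix (Fin dx) (Fin dx) ℝ) (Myy : Matrix (Fin dy) (Fin dy) ℝ)
    (hMxx : Mxx.PosDef) (hMyy : Myy.PosDef)
    (μ : Fin p → ℝ) (hμ_anti : StrictAnti μ) (hμ_pos : ∀ i, 0 < μ i)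
    (σ : Fin (min dx dy) → ℝ) (hσ : CCA.IsCanonicalCorrelations X Y lx ly σ)
    (hσ_gap : ∀ k, 1 ≤ k → k ≤ p → CCA.term σ (k + 1) < CCA.term σ k)
    (hσ_nonneg : 0 ≤ CCA.term σ (p + 1))
    (Z : Matrix (Fin dx ⊕ Fin dy) (Fin p) ℝ)
    (hZ : Z ∈ CCA.prodStiefel (CCA.gram X lx) (CCA.gram Y ly) p)
    (hZ_min : IsMinOn (CCA.cost (Xᵀ * Y) μ)
      (CCA.prodStiefel (CCA.gram X lx) (CCA.gram Y ly) p) Z) :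
    ∃ κH κP : ℝ,
      CCA.HasConditionNumber
        (CCA.riemannianHessianEigenvalues (CCA.blockDiag₂ Mxx Myy)
          (CCA.prodStiefelTangent (CCA.gram X lx) (CCA.gram Y ly))
          (CCA.cost (Xᵀ * Y) μ) Z) κH ∧
      CCA.HasConditionNumber
        (CCA.pencilEigenvalues (CCA.blockDiag₂ (CCA.gram X lx) (CCA.gram Y ly))
          (CCA.blockDiag₂ Mxx Myy)) κP ∧
      κH ≤ CCA.kappaStar p (CCA.term μ) (CCA.term σ) * κP ∧
      (CCA.blockDiag₂ Mxx Myy = CCA.blockDiag₂ (CCA.gram X lx) (CCA.gram Y ly) →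
        κH = CCA.kappaStar p (CCA.term μ) (CCA.term σ)) := by
  have hSxx : (CCA.gram X lx).PosDef := hS.submatrix (e := Sum.inl) Sum.inl_injective
  have hSyy : (CCA.gram Y ly).PosDef := hS.submatrix (e := Sum.inr) Sum.inr_injective
  have hx : p ≤ dx := hp_min.trans (min_le_left _ _)
  have hy : p ≤ dy := hp_min.trans (min_le_right _ _)
  obtain ⟨U, V, hfeas, hopt⟩ := hσ
  obtain ⟨hσ0, P, Q, hP, hQ, hPQ⟩ := CCA.exists_canonical_bases rfl hSxx hSyy hfeas hopt
  have hgap := CCA.isGapped_term hμ_anti hμ_pos hfeas.antitone hσ0 hσ_gap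
  have hμ : (fun k : Fin p => CCA.term μ (k + 1)) = μ := by
    ext k
    simp [CCA.term, Nat.succ_le_of_lt k.2]
  obtain ⟨P', Q', h, rfl⟩ := CCA.exists_adapted_bases hx hy hgap ⟨hP, hQ, hPQ⟩ hZ
    (by rwa [hμ])
  have := CCA.hasConditionNumber_hessian hp hx hy hp_max hSxx hSyy
    -- If `p` is the smaller dimension, σ at index `p + 1` is the default 0.
    (CCA.posDef_blockDiag₂ hMxx hMyy) hgap (fun hpm => by simp [CCA.term, ← hpm]) h
  rwa [hμ] at this
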